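/- Theorem 2. Let $I\subseteq\mathbb R$ be a nonempty open interval, let $H,G:I\to\mathbb R$ be smooth with $G+H^2>0$, put $D=\sqrt{G+H^2}$, and let $M=\{(t,x,y,z,u)\in\mathbb R^5: x\in I\}$ carry the five-dimensional Gödel-type Lorentzian metric $$ds^2=dt^2+2H(x)\,dt\,dy-dx^2-G(x)\,dy^2-dz^2-du^2 .$$ Suppose that $M$ is locally homogeneous, i.e. for all $p,q\in M$ there is an isometry from a neighbourhood of $p$ onto a neighbourhood of $q$ that takes $p$ to $q$. Then there are real constants $m^2$ (of either sign, or zero) and $\omega$ with $$\frac{H'}{D}=-2\omega,\qquad \frac{D''}{D}=m^2\qquad\text{on } I,$$ and the maximal local isometry group $G_r$ of $M$, i.e. the local group generated by all local Killing vector fields, acts transitively: on every connected nonempty open $U\subseteq M$ the values of the Killing vector fields of $U$ span the tangent space at each point of $U$. Moreover its number $r$ of parameters, i.e. the dimension of the space of Killing vector fields on each connected nonempty open $U\subseteq M$, is (i) $r=7$ if $m^2\neq4\omega^2$ and $\omega\neq0$; (ii) $r=9$ if $m^2=4\omega^2$ and $\omega\neq0$, or if $m^2\neq0$ and $\omega=0$.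 -/

import Mathlib

/-- The coordinate space `ℝ⁵`; the coordinates `0, 1, 2, 3, 4` are `t, x, y, z, u`. -/
abbrev Coord5 : Type := Fin 5 → ℝ

/-- The data of a five-dimensional Gödel-type line element
`ds² = dt² + 2 H(x) dt dy - dx² - G(x) dy² - dz² - du²`:
the open interval over which `x` ranges and the two smooth functions `H`, `G` on it, with
`G + H² > 0` (the metric is Lorentzian). -/
structure GodelType where
  /-- the range of the coordinate `x` -/
  I : Set ℝ
  /-- half the coefficient of `dt dy` -/
  H : ℝ → ℝ
  /-- minus the coefficient of `dy²` -/
  G : ℝ → ℝ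
  isOpen_I : IsOpen I
  isConnected_I : IsConnected I
  smooth_H : ContDiffOn ℝ (⊤ : ℕ∞) H I
  smooth_G : ContDiffOn ℝ (⊤ : ℕ∞) G I
  lorentzian : ∀ x ∈ I, 0 < G x + H x ^ 2

namespace GodelType

/-- The underlying manifold: the points `(t, x, y, z, u)` of `ℝ⁵` with `x ∈ I`. -/
def carrier (M : GodelType) : Set Coord5 := {p | p 1 ∈ M.I}

/-- The metric tensor at the point `p`, evaluated at two tangent vectors. -/
def metric (M : GodelType) (p v w : Coord5) : ℝ :=
  v 0 * w 0 + M.H (p 1) * (v 0 * w 2 + v 2 * w 0) - v 1 * w 1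
    - M.G (p 1) * (v 2 * w 2) - v 3 * w 3 - v 4 * w 4

/-- The function `D > 0` with `D² = G + H²`. -/
noncomputable def D (M : GodelType) (x : ℝ) : ℝ := Real.sqrt (M.G x + M.H x ^ 2)

/-- `H' / D` is the constant `-2ω` and `D'' / D` is the constant `m2` (written `m²`; it may be
negative). -/
def HasParameters (M : GodelType) (m2 ω : ℝ) : Prop :=
  ∀ x ∈ M.I, deriv M.H x / M.D x = -2 * ω ∧ deriv (deriv M.D) x / M.D x = m2

/-- `φ` is a local isometry of `M`: a smooth diffeomorphism between two open subsets of `M` that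
pulls the metric back to itself. -/
structure IsLocalIsometry (M : GodelType) (φ : OpenPartialHomeomorph Coord5 Coord5) : Prop where
  source_subset : φ.source ⊆ M.carrier
  target_subset : φ.target ⊆ M.carrier
  smooth : ContDiffOn ℝ (⊤ : ℕ∞) φ φ.source
  smooth_symm : ContDiffOn ℝ (⊤ : ℕ∞) φ.symm φ.target
  isometry : ∀ p ∈ φ.source, ∀ v w : Coord5,
    M.metric (φ p) (fderiv ℝ φ p v) (fderiv ℝ φ p w) = M.metric p v w

/-- Local homogeneity: any point can be carried to any other one by an isometry between
neighbourhoods of the two points. -/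
def IsLocallyHomogeneous (M : GodelType) : Prop :=
  ∀ p ∈ M.carrier, ∀ q ∈ M.carrier,
    ∃ φ : OpenPartialHomeomorph Coord5 Coord5, M.IsLocalIsometry φ ∧ p ∈ φ.source ∧ φ p = q

/-- The Lie derivative `L_K g` at the point `p`, evaluated at two tangent vectors; in components
`K^λ ∂_λ g_{μν} + g_{λν} ∂_μ K^λ + g_{μλ} ∂_ν K^λ`. -/
noncomputable def lieDerivMetric (M : GodelType) (K : Coord5 → Coord5) (p v w : Coord5) : ℝ :=
  fderiv ℝ (fun q => M.metric q v w) p (K p)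
    + M.metric p (fderiv ℝ K p v) w + M.metric p v (fderiv ℝ K p w)

/-- The maps `K : ℝ⁵ → ℝ⁵` that are smooth and satisfy the Killing equation `L_K g = 0` at all
points of `U`. -/
def killingOn (M : GodelType) (U : Set Coord5) : Submodule ℝ (Coord5 → Coord5) where
  carrier := {K | ∀ p ∈ U, ContDiffAt ℝ (⊤ : ℕ∞) K p ∧ ∀ v w, M.lieDerivMetric K p v w = 0}
  add_mem' := by
    intro K L hK hL p hp
    obtain ⟨hK1, hK2⟩ := hK p hp
    obtain ⟨hL1, hL2⟩ := hL p hp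
    refine ⟨hK1.add hL1, fun v w => ?_⟩
    have h1 := hK2 v w
    have h2 := hL2 v w
    have hadd : fderiv ℝ (K + L) p = fderiv ℝ K p + fderiv ℝ L p :=
      fderiv_add (hK1.differentiableAt (by simp)) (hL1.differentiableAt (by simp))
    simp only [lieDerivMetric, hadd, Pi.add_apply, map_add, add_apply] at *
    simp only [metric, Pi.add_apply] at *
    linarith
  zero_mem' := by
    intro p _
    refine ⟨contDiffAt_const, fun v w => ?_⟩
    simp [lieDerivMetric, metric]
  smul_mem' := by
    intro c K hK p hp
    obtain ⟨hK1, hK2⟩ := hK p hp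
    refine ⟨hK1.const_smul c, fun v w => ?_⟩
    have h1 := hK2 v w
    have hsmul : fderiv ℝ (c • K) p = c • fderiv ℝ K p :=
      fderiv_const_smul (hK1.differentiableAt (by simp)) c
    simp only [lieDerivMetric, hsmul, Pi.smul_apply, map_smul, smul_apply,
      smul_eq_mul] at *
    simp only [metric, Pi.smul_apply, smul_eq_mul] at *
    linear_combination c * h1

/-- The space of all Killing vector fields on the open set `U`, as functions on `U`. It is the Lie
algebra of the maximal local group of isometries of `U`. -/
def killingFields (M : GodelType) (U : Set Coord5) : Submodule ℝ (U → Coord5) :=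
  (M.killingOn U).map (LinearMap.funLeft ℝ Coord5 (Subtype.val : U → Coord5))

/-- The maximal local isometry group of `M` is an `r`-parameter group: over every connected open
piece `U` of `M`, the Killing vector fields on `U` form a space of dimension `r`. -/
def MaximalIsometryGroupDim (M : GodelType) (r : ℕ) : Prop :=
  ∀ U : Set Coord5, IsOpen U → IsConnected U → U ⊆ M.carrier →
    Module.rank ℝ (M.killingFields U) = r

/-- The maximal local isometry group acts transitively, that is, with orbits of dimension five:
over every connected open piece `U` of `M`, at each point of `U` every tangent vector is the value
of a Killing vector field on `U`. -/
def IsometryGroupTransitive (M : GodelType) : Prop :=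
  ∀ U : Set Coord5, IsOpen U → IsConnected U → U ⊆ M.carrier →
    ∀ p : U, ∀ v : Coord5, ∃ K ∈ M.killingFields U, K p = v

end GodelType

/-! In the orthonormal coframe `dt + H dy`, `dx`, `D dy`, `dz`, `du` the curvature depends only on
`f = H'/D`, `f'` and `D''/D`. A local isometry conjugates the Ricci endomorphisms at its two end
points. One Ricci eigenvalue is `D''/D - f²/2`, with eigenvector `∂_x`, and the trace is `2 D''/D -
f²/2`. Under local homogeneity the trace is constant, and the eigenvalue is a continuous function
with values in a finite spectrum, hence constant too. So `D''/D` and `f²` are constant, and `f` is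
constant by continuity (`IsLocallyHomogeneous.exists_hasParameters`).

The dimension is then found from two sides. From above: a Killing field on a connected open set is
determined by its value and derivative at one point (`IsLeviCivita.killing_eq_zero`). If the value
is zero, the derivative is skew and annihilates the curvature tensor
(`IsLeviCivita.curvature_of_killing`). With constant parameters these conditions are linear algebra.
The rotations of the `x, y` and `z, u` planes always survive. Mixing of the time direction with `x,
y` requires `m² = 4ω²`, and for `ω ≠ 0` nothing mixes `z, u` with the other directions. For `ω = 0`,
`m² ≠ 0` the survivors are the Lorentz algebra of `t, z, u` and the rotation of the `x, y` plane.

From below: explicit Killing fields realise every admissible first jet. They are translations, the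
rotation of `z, u`, lifts of the Killing fields of the constant curvature surface `dx² + D² dy²`,
and the additional fields of the two special cases. Geometrically the `t, x, y` factor has constant
curvature when `m² = 4ω² ≠ 0`, and for `ω = 0` the space is locally flat three-dimensional spacetime
times the surface. The counts are `5 + 2` and `5 + 4`. -/

open Topology Filter

/-! ### Isometries, Killing fields and curvature of a general metric. -/

section LeviCivita

set_option synthInstance.maxHeartbeats 200000
set_option maxSynthPendingDepth 5

variable {E : Type*} [NormedAddCommGroup E] [NormedSpace ℝ E]

/-- `Γ` is (the Christoffel symbol of) the Levi-Civita connection of the smooth nondegenerate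
symmetric tensor `g` on the open set `Ω`. -/
structure IsLeviCivita (g : E → E →L[ℝ] E →L[ℝ] ℝ) (Γ : E → E →L[ℝ] E →L[ℝ] E) (Ω : Set E) :
    Prop where
  isOpen : IsOpen Ω
  contDiffOn_metric : ContDiffOn ℝ (⊤ : ℕ∞) g Ω
  contDiffOn_christoffel : ContDiffOn ℝ (⊤ : ℕ∞) Γ Ω
  symm : ∀ p ∈ Ω, ∀ v w, g p v w = g p w v
  nondegenerate : ∀ p ∈ Ω, ∀ v, (∀ w, g p v w = 0) → v = 0
  torsionFree : ∀ p ∈ Ω, ∀ v w, Γ p v w = Γ p w v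
  compatible : ∀ p ∈ Ω, ∀ u v w, fderiv ℝ g p u v w = g p (Γ p u v) w + g p v (Γ p u w)

/-- The curvature tensor of the connection with Christoffel symbol `Γ`. -/
noncomputable def curvature (Γ : E → E →L[ℝ] E →L[ℝ] E) (p u v w : E) : E :=
  fderiv ℝ Γ p u v w - fderiv ℝ Γ p v u w + Γ p u (Γ p v w) - Γ p v (Γ p u w)

variable {g : E → E →L[ℝ] E →L[ℝ] ℝ} {Γ : E → E →L[ℝ] E →L[ℝ] E} {Ω : Set E}

theorem minSmoothness_two_le_top : minSmoothness ℝ 2 ≤ ((⊤ : ℕ∞) : WithTop ℕ∞) := by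
  simp only [minSmoothness_of_isRCLikeNormedField]
  exact WithTop.coe_le_coe.2 (le_top : (2 : ℕ∞) ≤ ⊤)

/-- A trilinear expression symmetric in the first two and skew in the last two arguments
vanishes. -/
theorem eq_zero_of_symm_of_skew {α : Type*} {t : α → α → α → ℝ} (hs : ∀ u v w, t u v w = t v u w)
    (ha : ∀ u v w, t u v w = -t u w v) (u v w : α) : t u v w = 0 := by
  have h1 := hs u v w
  have h2 := ha v u w
  have h3 := hs v w u
  have h4 := ha w v u
  have h5 := hs w u v
  have h6 := ha u w v
  linarith

theorem IsLeviCivita.differentiableAt_metric (h : IsLeviCivita g Γ Ω) {p : E} (hp : p ∈ Ω) :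
    DifferentiableAt ℝ g p :=
  (h.contDiffOn_metric.contDiffAt (h.isOpen.mem_nhds hp)).differentiableAt (by simp)

theorem IsLeviCivita.differentiableAt_christoffel (h : IsLeviCivita g Γ Ω) {p : E} (hp : p ∈ Ω) :
    DifferentiableAt ℝ Γ p :=
  (h.contDiffOn_christoffel.contDiffAt (h.isOpen.mem_nhds hp)).differentiableAt (by simp)

theorem IsLeviCivita.fderiv_christoffel_symm (h : IsLeviCivita g Γ Ω) {p : E} (hp : p ∈ Ω)
    (u v w : E) : fderiv ℝ Γ p u v w = fderiv ℝ Γ p u w v := by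
  have hΓ := (h.differentiableAt_christoffel hp).hasFDerivAt
  have h1 := (hΓ.clm_apply (hasFDerivAt_const v p)).clm_apply (hasFDerivAt_const w p)
  have h2 := (hΓ.clm_apply (hasFDerivAt_const w p)).clm_apply (hasFDerivAt_const v p)
  have h3 : (fun x => Γ x v w) =ᶠ[𝓝 p] fun x => Γ x w v :=
    Filter.eventually_of_mem (h.isOpen.mem_nhds hp) fun x hx => h.torsionFree x hx v w
  have := congrArg (fun L => L u) (h1.unique (h2.congr_of_eventuallyEq h3))
  simpa using this

/-- The second derivative of a map preserving `g`. -/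
theorem IsLeviCivita.fderiv_fderiv_of_isometry (h : IsLeviCivita g Γ Ω) {φ : E → E} {V : Set E}
    (hV : IsOpen V) (hVΩ : V ⊆ Ω) (hφ : ContDiffOn ℝ (⊤ : ℕ∞) φ V) (hmaps : Set.MapsTo φ V Ω)
    (hiso : ∀ p ∈ V, ∀ v w, g (φ p) (fderiv ℝ φ p v) (fderiv ℝ φ p w) = g p v w)
    (hsurj : ∀ p ∈ V, Function.Surjective (fderiv ℝ φ p)) {p : E} (hp : p ∈ V) (u v : E) :
    fderiv ℝ (fderiv ℝ φ) p u v =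
      fderiv ℝ φ p (Γ p u v) - Γ (φ p) (fderiv ℝ φ p u) (fderiv ℝ φ p v) := by
  have hφp : ContDiffAt ℝ (⊤ : ℕ∞) φ p := hφ.contDiffAt (hV.mem_nhds hp)
  have hsymm : IsSymmSndFDerivAt ℝ φ p := hφp.isSymmSndFDerivAt minSmoothness_two_le_top
  have hF : HasFDerivAt (fderiv ℝ φ) (fderiv ℝ (fderiv ℝ φ) p) p :=
    ((hφp.fderiv_right (m := (⊤ : ℕ∞)) (by simp)).differentiableAt (by simp)).hasFDerivAt
  have hφ' : HasFDerivAt φ (fderiv ℝ φ p) p := (hφp.differentiableAt (by simp)).hasFDerivAt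
  have hg' := (h.differentiableAt_metric (hmaps hp)).hasFDerivAt
  have hg := (h.differentiableAt_metric (hVΩ hp)).hasFDerivAt
  set B := fderiv ℝ φ p with hB
  set F2 := fderiv ℝ (fderiv ℝ φ) p with hF2
  -- The isometry equation differentiated in the direction `u`.
  have key : ∀ u v w : E, fderiv ℝ g (φ p) (B u) (B v) (B w) + g (φ p) (F2 u v) (B w)
      + g (φ p) (B v) (F2 u w) = fderiv ℝ g p u v w := by
    intro u v w
    have h0 : HasFDerivAt (fun x => g (φ x)) ((fderiv ℝ g (φ p)).comp B) p := hg'.comp p hφ'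
    have h1 := (h0.clm_apply
      (hF.clm_apply (hasFDerivAt_const v p))).clm_apply (hF.clm_apply (hasFDerivAt_const w p))
    have h2 := (hg.clm_apply (hasFDerivAt_const v p)).clm_apply (hasFDerivAt_const w p)
    have h3 : (fun x => g (φ x) (fderiv ℝ φ x v) (fderiv ℝ φ x w)) =ᶠ[𝓝 p] fun x => g x v w :=
      Filter.eventually_of_mem (hV.mem_nhds hp) fun x hx => hiso x hx v w
    have := congrArg (fun L => L u) (h1.unique (h2.congr_of_eventuallyEq h3))
    simp at this
    rw [← this]
    simp only [← hB]
    ring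
  -- Uniqueness of the Levi-Civita connection: the defect is symmetric in `u, v` because second
  -- derivatives commute and there is no torsion, and skew in `v, w` by `key` and metric
  -- compatibility.
  have hT : ∀ u v w, g (φ p) (F2 u v + Γ (φ p) (B u) (B v) - B (Γ p u v)) (B w) = 0 := by
    refine eq_zero_of_symm_of_skew (fun u v w => ?_) (fun u v w => ?_)
    · rw [hsymm u v, h.torsionFree _ (hmaps hp) (B u), h.torsionFree _ (hVΩ hp) u]
    · have h1 := key u v w
      rw [h.compatible _ (hmaps hp), h.compatible _ (hVΩ hp), ← hiso p hp (Γ p u v) w,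
        ← hiso p hp v (Γ p u w)] at h1
      simp only [map_add, map_sub, add_apply, sub_apply]
      rw [h.symm _ (hmaps hp) (F2 u w), h.symm _ (hmaps hp) _ (B v),
        h.symm _ (hmaps hp) (B (Γ p u w))]
      linarith
  have h0 : F2 u v + Γ (φ p) (B u) (B v) - B (Γ p u v) = 0 := by
    refine h.nondegenerate _ (hmaps hp) _ fun w => ?_
    obtain ⟨w, rfl⟩ := hsurj p hp w
    exact hT u v w
  rw [← sub_eq_zero, ← h0]
  abel

/-- A map preserving `g` preserves the curvature tensor. -/
theorem IsLeviCivita.curvature_of_isometry (h : IsLeviCivita g Γ Ω) {φ : E → E} {V : Set E}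
    (hV : IsOpen V) (hVΩ : V ⊆ Ω) (hφ : ContDiffOn ℝ (⊤ : ℕ∞) φ V) (hmaps : Set.MapsTo φ V Ω)
    (hiso : ∀ p ∈ V, ∀ v w, g (φ p) (fderiv ℝ φ p v) (fderiv ℝ φ p w) = g p v w)
    (hsurj : ∀ p ∈ V, Function.Surjective (fderiv ℝ φ p)) {p : E} (hp : p ∈ V) (u v w : E) :
    fderiv ℝ φ p (curvature Γ p u v w) =
      curvature Γ (φ p) (fderiv ℝ φ p u) (fderiv ℝ φ p v) (fderiv ℝ φ p w) := by
  have hform := fun q (hq : q ∈ V) => h.fderiv_fderiv_of_isometry hV hVΩ hφ hmaps hiso hsurj hq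
  have hφp : ContDiffAt ℝ (⊤ : ℕ∞) φ p := hφ.contDiffAt (hV.mem_nhds hp)
  have hsymm : IsSymmSndFDerivAt ℝ φ p := hφp.isSymmSndFDerivAt minSmoothness_two_le_top
  have hFc : ContDiffAt ℝ (⊤ : ℕ∞) (fderiv ℝ φ) p := hφp.fderiv_right (by simp)
  have hsymm3 : IsSymmSndFDerivAt ℝ (fderiv ℝ φ) p := hFc.isSymmSndFDerivAt minSmoothness_two_le_top
  have hF : HasFDerivAt (fderiv ℝ φ) (fderiv ℝ (fderiv ℝ φ) p) p :=
    (hFc.differentiableAt (by simp)).hasFDerivAt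
  have hF3 : HasFDerivAt (fderiv ℝ (fderiv ℝ φ)) (fderiv ℝ (fderiv ℝ (fderiv ℝ φ)) p) p :=
    ((hFc.fderiv_right (m := (⊤ : ℕ∞)) (by simp)).differentiableAt (by simp)).hasFDerivAt
  have hφ' : HasFDerivAt φ (fderiv ℝ φ p) p := (hφp.differentiableAt (by simp)).hasFDerivAt
  have hΓ' := (h.differentiableAt_christoffel (hmaps hp)).hasFDerivAt
  have hΓ := (h.differentiableAt_christoffel (hVΩ hp)).hasFDerivAt
  have hf := hform p hp
  set B := fderiv ℝ φ p with hB
  set F2 := fderiv ℝ (fderiv ℝ φ) p with hF2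
  set F3 := fderiv ℝ (fderiv ℝ (fderiv ℝ φ)) p with hF3'
  -- Differentiating the formula for the second derivative once more. Symmetry of the third
  -- derivative in `u, v` is the integrability condition, and it is exactly the invariance of the
  -- curvature.
  have key : ∀ u v w : E, F3 u v w = F2 u (Γ p v w) + B (fderiv ℝ Γ p u v w)
      - fderiv ℝ Γ (φ p) (B u) (B v) (B w) - Γ (φ p) (F2 u v) (B w) - Γ (φ p) (B v) (F2 u w) := by
    intro u v w
    have h0 : HasFDerivAt (fun x => Γ (φ x)) ((fderiv ℝ Γ (φ p)).comp B) p := hΓ'.comp p hφ'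
    have h1 := (hF.clm_apply ((hΓ.clm_apply (hasFDerivAt_const v p)).clm_apply
      (hasFDerivAt_const w p))).sub ((h0.clm_apply
      (hF.clm_apply (hasFDerivAt_const v p))).clm_apply (hF.clm_apply (hasFDerivAt_const w p)))
    have h2 := (hF3.clm_apply (hasFDerivAt_const v p)).clm_apply (hasFDerivAt_const w p)
    have h3 : (fun x => fderiv ℝ (fderiv ℝ φ) x v w) =ᶠ[𝓝 p] fun x => fderiv ℝ φ x (Γ x v w) -
        Γ (φ x) (fderiv ℝ φ x v) (fderiv ℝ φ x w) :=
      Filter.eventually_of_mem (hV.mem_nhds hp) fun x hx => hform x hx v w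
    have := congrArg (fun L => L u) (h2.unique (h1.congr_of_eventuallyEq h3))
    simp at this
    rw [this]
    simp only [← hB]
    abel
  have e1 := key u v w
  have e2 := key v u w
  have e3 : F3 u v w = F3 v u w := congrArg (fun L => L w) (hsymm3 u v)
  rw [hsymm v u] at e2
  rw [e3, e2] at e1
  rw [hf u (Γ p v w), hf v (Γ p u w), hf u w, hf v w] at e1
  simp only [curvature, map_add, map_sub] at e1 ⊢
  rw [← sub_eq_zero] at e1 ⊢
  rw [← neg_eq_zero, ← e1]
  abel

/-- The second derivative of a Killing vector field. -/
theorem IsLeviCivita.fderiv_fderiv_of_killing (h : IsLeviCivita g Γ Ω) {K : E → E} {V : Set E}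
    (hV : IsOpen V) (hVΩ : V ⊆ Ω) (hK : ContDiffOn ℝ (⊤ : ℕ∞) K V)
    (hkill : ∀ p ∈ V, ∀ v w, fderiv ℝ g p (K p) v w + g p (fderiv ℝ K p v) w
      + g p v (fderiv ℝ K p w) = 0) {p : E} (hp : p ∈ V) (u v : E) :
    fderiv ℝ (fderiv ℝ K) p u v = fderiv ℝ K p (Γ p u v) - fderiv ℝ Γ p (K p) u v
      - Γ p (fderiv ℝ K p u) v - Γ p u (fderiv ℝ K p v) := by
  have hKp : ContDiffAt ℝ (⊤ : ℕ∞) K p := hK.contDiffAt (hV.mem_nhds hp)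
  have hsymm : IsSymmSndFDerivAt ℝ K p := hKp.isSymmSndFDerivAt minSmoothness_two_le_top
  have hA : HasFDerivAt (fderiv ℝ K) (fderiv ℝ (fderiv ℝ K) p) p :=
    ((hKp.fderiv_right (m := (⊤ : ℕ∞)) (by simp)).differentiableAt (by simp)).hasFDerivAt
  have hK' : HasFDerivAt K (fderiv ℝ K p) p := (hKp.differentiableAt (by simp)).hasFDerivAt
  have hgp : ContDiffAt ℝ (⊤ : ℕ∞) g p := h.contDiffOn_metric.contDiffAt (h.isOpen.mem_nhds (hVΩ hp))
  have hg := (h.differentiableAt_metric (hVΩ hp)).hasFDerivAt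
  have hΓ := (h.differentiableAt_christoffel (hVΩ hp)).hasFDerivAt
  have hg2 : HasFDerivAt (fderiv ℝ g) (fderiv ℝ (fderiv ℝ g) p) p :=
    ((hgp.fderiv_right (m := (⊤ : ℕ∞)) (by simp)).differentiableAt (by simp)).hasFDerivAt
  have hgsymm : IsSymmSndFDerivAt ℝ g p := hgp.isSymmSndFDerivAt minSmoothness_two_le_top
  set A := fderiv ℝ K p with hA'
  set A2 := fderiv ℝ (fderiv ℝ K) p with hA2
  set g2 := fderiv ℝ (fderiv ℝ g) p with hg2'
  have key : ∀ u v w : E, g2 u (K p) v w + fderiv ℝ g p (A u) v w + fderiv ℝ g p u (A v) w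
      + g p (A2 u v) w + fderiv ℝ g p u v (A w) + g p v (A2 u w) = 0 := by
    intro u v w
    have h1 := ((((hg2.clm_apply hK').clm_apply (hasFDerivAt_const v p)).clm_apply
      (hasFDerivAt_const w p)).add ((hg.clm_apply (hA.clm_apply (hasFDerivAt_const v p))).clm_apply
      (hasFDerivAt_const w p))).add ((hg.clm_apply (hasFDerivAt_const v p)).clm_apply
      (hA.clm_apply (hasFDerivAt_const w p)))
    have h3 : (fun _ => (0 : ℝ)) =ᶠ[𝓝 p] fun x => fderiv ℝ g x (K x) v w + g x (fderiv ℝ K x v) w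
      + g x v (fderiv ℝ K x w)  :=
      Filter.eventually_of_mem (hV.mem_nhds hp) fun x hx => (hkill x hx v w).symm
    have := congrArg (fun L => L u) ((hasFDerivAt_const (0 : ℝ) p).unique
      (h1.congr_of_eventuallyEq h3))
    simp at this
    simp only [← hA'] at this
    linarith
  have key2 : ∀ k u v w : E, g2 k u v w = fderiv ℝ g p k (Γ p u v) w
      + g p (fderiv ℝ Γ p k u v) w + fderiv ℝ g p k v (Γ p u w) + g p v (fderiv ℝ Γ p k u w) := by
    intro k u v w
    have h1 := (((hg.clm_apply ((hΓ.clm_apply (hasFDerivAt_const u p)).clm_apply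
      (hasFDerivAt_const v p))).clm_apply (hasFDerivAt_const w p))).add
      ((hg.clm_apply (hasFDerivAt_const v p)).clm_apply
      ((hΓ.clm_apply (hasFDerivAt_const u p)).clm_apply (hasFDerivAt_const w p)))
    have h2 := ((hg2.clm_apply (hasFDerivAt_const u p)).clm_apply (hasFDerivAt_const v p)).clm_apply
      (hasFDerivAt_const w p)
    have h3 : (fun x => fderiv ℝ g x u v w) =ᶠ[𝓝 p] fun x => g x (Γ x u v) w + g x v (Γ x u w) :=
      Filter.eventually_of_mem (h.isOpen.mem_nhds (hVΩ hp)) fun x hx => h.compatible x hx u v w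
    have := congrArg (fun L => L k) (h2.unique (h1.congr_of_eventuallyEq h3))
    simp at this
    linarith
  -- The vector in the first slot is `(L_K Γ)(u, v)`. It vanishes by the same symmetric-skew
  -- argument, applied to the derivatives of the Killing equation and of the compatibility
  -- condition.
  have hT : ∀ u v w, g p (A2 u v + fderiv ℝ Γ p (K p) u v + Γ p (A u) v + Γ p u (A v)
      - A (Γ p u v)) w = 0 := by
    refine eq_zero_of_symm_of_skew (fun u v w => ?_) (fun u v w => ?_)
    · rw [hsymm u v, h.torsionFree _ (hVΩ hp) (A u), h.torsionFree _ (hVΩ hp) u (A v),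
        h.torsionFree _ (hVΩ hp) u v, h.fderiv_christoffel_symm (hVΩ hp) _ u v]
      congr 2
      abel
    · have h1 := key u v w
      have h2 := key2 (K p) u v w
      have h3 : g2 u (K p) v w = g2 (K p) u v w :=
        congrArg (fun L => L v w) (hgsymm u (K p))
      have h4 := hkill p hp (Γ p u v) w
      have h5 := hkill p hp v (Γ p u w)
      have e := h.compatible p (hVΩ hp)
      rw [e (A u), e u (A v), e u v (A w), h3, h2] at h1
      simp only [← hA'] at h4 h5
      simp only [map_add, map_sub, add_apply, sub_apply]
      have s := fun a => h.symm p (hVΩ hp) a v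
      rw [s (A2 u w), s (fderiv ℝ Γ p (K p) u w), s (Γ p (A u) w), s (Γ p u (A w)),
        s (A (Γ p u w))]
      linarith
  have h0 := h.nondegenerate _ (hVΩ hp) _ (hT u v)
  rw [← sub_eq_zero, ← h0]
  abel

/-- At a zero of a Killing vector field its derivative acts trivially on the curvature tensor. -/
theorem IsLeviCivita.curvature_of_killing (h : IsLeviCivita g Γ Ω) {K : E → E} {V : Set E}
    (hV : IsOpen V) (hVΩ : V ⊆ Ω) (hK : ContDiffOn ℝ (⊤ : ℕ∞) K V)
    (hkill : ∀ p ∈ V, ∀ v w, fderiv ℝ g p (K p) v w + g p (fderiv ℝ K p v) w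
      + g p v (fderiv ℝ K p w) = 0) {p : E} (hp : p ∈ V) (hKp0 : K p = 0) (u v w : E) :
    fderiv ℝ K p (curvature Γ p u v w) = curvature Γ p (fderiv ℝ K p u) v w
      + curvature Γ p u (fderiv ℝ K p v) w + curvature Γ p u v (fderiv ℝ K p w) := by
  have hform := fun q (hq : q ∈ V) => h.fderiv_fderiv_of_killing hV hVΩ hK hkill hq
  have hKp : ContDiffAt ℝ (⊤ : ℕ∞) K p := hK.contDiffAt (hV.mem_nhds hp)
  have hsymm : IsSymmSndFDerivAt ℝ K p := hKp.isSymmSndFDerivAt minSmoothness_two_le_top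
  have hAc : ContDiffAt ℝ (⊤ : ℕ∞) (fderiv ℝ K) p := hKp.fderiv_right (by simp)
  have hsymm3 : IsSymmSndFDerivAt ℝ (fderiv ℝ K) p := hAc.isSymmSndFDerivAt minSmoothness_two_le_top
  have hA : HasFDerivAt (fderiv ℝ K) (fderiv ℝ (fderiv ℝ K) p) p :=
    (hAc.differentiableAt (by simp)).hasFDerivAt
  have hA3 : HasFDerivAt (fderiv ℝ (fderiv ℝ K)) (fderiv ℝ (fderiv ℝ (fderiv ℝ K)) p) p :=
    ((hAc.fderiv_right (m := (⊤ : ℕ∞)) (by simp)).differentiableAt (by simp)).hasFDerivAt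
  have hK' : HasFDerivAt K (fderiv ℝ K p) p := (hKp.differentiableAt (by simp)).hasFDerivAt
  have hΓp : ContDiffAt ℝ (⊤ : ℕ∞) Γ p :=
    h.contDiffOn_christoffel.contDiffAt (h.isOpen.mem_nhds (hVΩ hp))
  have hΓ := (h.differentiableAt_christoffel (hVΩ hp)).hasFDerivAt
  have hΓ2 : HasFDerivAt (fderiv ℝ Γ) (fderiv ℝ (fderiv ℝ Γ) p) p :=
    ((hΓp.fderiv_right (m := (⊤ : ℕ∞)) (by simp)).differentiableAt (by simp)).hasFDerivAt
  have hf := hform p hp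
  set A := fderiv ℝ K p with hA'
  set A2 := fderiv ℝ (fderiv ℝ K) p with hA2
  set A3 := fderiv ℝ (fderiv ℝ (fderiv ℝ K)) p with hA3'
  -- The term with the second derivative of `Γ` carries the factor `K p = 0` and is absent here.
  have key : ∀ u v w : E, A3 u v w = A2 u (Γ p v w) + A (fderiv ℝ Γ p u v w)
      - fderiv ℝ Γ p (A u) v w - fderiv ℝ Γ p u (A v) w - Γ p (A2 u v) w
      - fderiv ℝ Γ p u v (A w) - Γ p v (A2 u w) := by
    intro u v w
    have h1 := (((hA.clm_apply ((hΓ.clm_apply (hasFDerivAt_const v p)).clm_apply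
      (hasFDerivAt_const w p))).sub (((hΓ2.clm_apply hK').clm_apply
      (hasFDerivAt_const v p)).clm_apply (hasFDerivAt_const w p))).sub
      ((hΓ.clm_apply (hA.clm_apply (hasFDerivAt_const v p))).clm_apply
      (hasFDerivAt_const w p))).sub ((hΓ.clm_apply (hasFDerivAt_const v p)).clm_apply
      (hA.clm_apply (hasFDerivAt_const w p)))
    have h2 := (hA3.clm_apply (hasFDerivAt_const v p)).clm_apply (hasFDerivAt_const w p)
    have h3 : (fun x => fderiv ℝ (fderiv ℝ K) x v w) =ᶠ[𝓝 p] fun x => fderiv ℝ K x (Γ x v w)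
        - fderiv ℝ Γ x (K x) v w - Γ x (fderiv ℝ K x v) w - Γ x v (fderiv ℝ K x w) :=
      Filter.eventually_of_mem (hV.mem_nhds hp) fun x hx => hform x hx v w
    have := congrArg (fun L => L u) (h2.unique (h1.congr_of_eventuallyEq h3))
    simp [hKp0] at this
    rw [this]
    simp only [← hA']
    abel
  have e1 := key u v w
  have e2 := key v u w
  have e3 : A3 u v w = A3 v u w := congrArg (fun L => L w) (hsymm3 u v)
  rw [hsymm v u] at e2
  rw [e3, e2] at e1
  rw [hf u (Γ p v w), hf v (Γ p u w), hf u w, hf v w] at e1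
  simp only [hKp0, map_zero, zero_apply, sub_zero] at e1
  simp only [curvature, map_add, map_sub] at e1 ⊢
  rw [← sub_eq_zero] at e1 ⊢
  rw [← neg_eq_zero, ← e1]
  abel

end LeviCivita

/-! ### Unique continuation of Killing fields from a first jet. -/

section Uniqueness

set_option synthInstance.maxHeartbeats 200000
set_option maxSynthPendingDepth 5

variable {E : Type*} [NormedAddCommGroup E] [NormedSpace ℝ E]
variable {W : Type*} [NormedAddCommGroup W] [NormedSpace ℝ W]

/-- Grönwall's inequality on each segment from `x` to `y`: the restriction of `Y` starts at zero and
its derivative is bounded by `C ‖y - x‖` times its norm. -/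
theorem eventually_eq_zero_of_norm_fderiv_le {Y : E → W} {x : E} {C : ℝ} (hx : Y x = 0)
    (hY : ∀ᶠ y in 𝓝 x, DifferentiableAt ℝ Y y)
    (hC : ∀ᶠ y in 𝓝 x, ‖fderiv ℝ Y y‖ ≤ C * ‖Y y‖) : ∀ᶠ y in 𝓝 x, Y y = 0 := by
  obtain ⟨r, hr, hball⟩ := Metric.eventually_nhds_iff_ball.1 (hY.and hC)
  refine Metric.eventually_nhds_iff_ball.2 ⟨r, hr, fun y hy => ?_⟩
  have hseg : ∀ t ∈ Set.Icc (0 : ℝ) 1, x + t • (y - x) ∈ Metric.ball x r := by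
    intro t ht
    rw [mem_ball_iff_norm] at hy ⊢
    rw [add_sub_cancel_left, norm_smul, Real.norm_of_nonneg ht.1]
    nlinarith [norm_nonneg (y - x), ht.2]
  have hder : ∀ t ∈ Set.Icc (0 : ℝ) 1, HasDerivAt (fun t : ℝ => Y (x + t • (y - x)))
      (fderiv ℝ Y (x + t • (y - x)) (y - x)) t := by
    intro t ht
    have h1 : HasDerivAt (fun t : ℝ => x + t • (y - x)) (y - x) t := by
      simpa using ((hasDerivAt_id t).smul_const (y - x)).const_add x
    exact ((hball _ (hseg t ht)).1.hasFDerivAt).comp_hasDerivAt t h1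
  have := eq_zero_of_abs_deriv_le_mul_abs_self_of_eq_zero_right (a := 0) (b := 1)
    (K := C * ‖y - x‖)
    (f := fun t : ℝ => Y (x + t • (y - x)))
    (f' := fun t : ℝ => fderiv ℝ Y (x + t • (y - x)) (y - x))
    (fun t ht => (hder t ht).continuousAt.continuousWithinAt)
    (fun t ht => (hder t ⟨ht.1, ht.2.le⟩).hasDerivWithinAt) (by simpa using hx)
    (fun t ht => by
      refine (ContinuousLinearMap.le_opNorm _ _).trans ?_
      calc _ ≤ C * ‖Y (x + t • (y - x))‖ * ‖y - x‖ := by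
            gcongr
            exact (hball _ (hseg t ⟨ht.1, ht.2.le⟩)).2
        _ = _ := by ring) 1 (by simp)
  simpa using this

/-- A solution of a homogeneous linear total differential equation that vanishes at one point of a
connected open set vanishes on all of it. -/
theorem eqOn_zero_of_norm_fderiv_le {Y : E → W} {V : Set E} (hV : IsOpen V)
    (hVc : IsPreconnected V) (hY : ∀ x ∈ V, DifferentiableAt ℝ Y x)
    (hC : ∀ x ∈ V, ∃ C : ℝ, ∀ᶠ y in 𝓝 x, ‖fderiv ℝ Y y‖ ≤ C * ‖Y y‖) {p : E} (hp : p ∈ V)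
    (hYp : Y p = 0) : ∀ x ∈ V, Y x = 0 := by
  have hloc : ∀ x ∈ V, Y x = 0 → ∀ᶠ y in 𝓝 x, Y y = 0 := fun x hx h0 => by
    obtain ⟨C, hC⟩ := hC x hx
    exact eventually_eq_zero_of_norm_fderiv_le h0 (eventually_of_mem (hV.mem_nhds hx) hY) hC
  -- The set where the germ of `Y` vanishes is open, and closed relative to `V`: at a limit point
  -- `Y` is zero by continuity, so the local statement applies there.
  have hsub : V ⊆ {x | ∀ᶠ y in 𝓝 x, Y y = 0} := by
    refine hVc.subset_of_closure_inter_subset isOpen_setOfPred_eventually_nhds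
      ⟨p, hp, hloc p hp hYp⟩ ?_
    rintro x ⟨hxc, hxV⟩
    refine hloc x hxV ?_
    by_contra hne
    obtain ⟨y, hy1, hy2⟩ := mem_closure_iff_nhds.1 hxc _ ((hY x hxV).continuousAt.eventually_ne hne)
    exact hy1 hy2.self_of_nhds
  exact fun x hx => (hsub hx).self_of_nhds

variable {g : E → E →L[ℝ] E →L[ℝ] ℝ} {Γ : E → E →L[ℝ] E →L[ℝ] E} {Ω : Set E}

/-- A Killing vector field on a connected open set is determined by its first jet at a point. -/
theorem IsLeviCivita.killing_eq_zero (h : IsLeviCivita g Γ Ω) {K : E → E} {V : Set E}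
    (hV : IsOpen V) (hVc : IsPreconnected V) (hVΩ : V ⊆ Ω) (hK : ContDiffOn ℝ (⊤ : ℕ∞) K V)
    (hkill : ∀ p ∈ V, ∀ v w, fderiv ℝ g p (K p) v w + g p (fderiv ℝ K p v) w
      + g p v (fderiv ℝ K p w) = 0) {p : E} (hp : p ∈ V) (hKp : K p = 0)
    (hdKp : fderiv ℝ K p = 0) : ∀ x ∈ V, K x = 0 := by
  have hKc : ∀ x ∈ V, ContDiffAt ℝ (⊤ : ℕ∞) K x := fun x hx => hK.contDiffAt (hV.mem_nhds hx)
  have hd : ∀ x ∈ V, HasFDerivAt (fun x => (K x, fderiv ℝ K x))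
      ((fderiv ℝ K x).prod (fderiv ℝ (fderiv ℝ K) x)) x := fun x hx =>
    ((hKc x hx).differentiableAt (by simp)).hasFDerivAt.prodMk
      (((hKc x hx).fderiv_right (m := (⊤ : ℕ∞)) (by simp)).differentiableAt (by simp)).hasFDerivAt
  have := eqOn_zero_of_norm_fderiv_le (Y := fun x => (K x, fderiv ℝ K x)) hV hVc
    (fun x hx => (hd x hx).differentiableAt) ?_ hp (by simp [hKp, hdKp])
  · exact fun x hx => congrArg Prod.fst (this x hx)
  intro x hx
  have hΓx : ContDiffAt ℝ (⊤ : ℕ∞) Γ x :=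
    h.contDiffOn_christoffel.contDiffAt (h.isOpen.mem_nhds (hVΩ hx))
  have b1 := hΓx.continuousAt.norm.eventually_lt_const (lt_add_one _)
  have b2 := (hΓx.fderiv_right (m := (⊤ : ℕ∞)) (by simp)).continuousAt.norm.eventually_lt_const
    (lt_add_one _)
  set c1 := ‖Γ x‖ + 1
  set c2 := ‖fderiv ℝ Γ x‖ + 1
  have hc1 : 0 ≤ c1 := by positivity
  have hc2 : 0 ≤ c2 := by positivity
  -- The pair `(K, dK)` solves a linear system. The summand `1` bounds the derivative of `K`. The
  -- three terms with `Γ` and the one with its derivative in the formula for the second derivative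
  -- give `3 * c1 + c2`.
  refine ⟨1 + (3 * c1 + c2), ?_⟩
  filter_upwards [b1, b2, hV.mem_nhds hx] with y h1 h2 hy
  rw [(hd y hy).fderiv]
  have n1 : ‖K y‖ ≤ ‖(K y, fderiv ℝ K y)‖ := norm_fst_le (K y, fderiv ℝ K y)
  have n2 : ‖fderiv ℝ K y‖ ≤ ‖(K y, fderiv ℝ K y)‖ := norm_snd_le (K y, fderiv ℝ K y)
  set N := ‖(K y, fderiv ℝ K y)‖ with hN
  have hN0 : 0 ≤ N := norm_nonneg _
  refine (ContinuousLinearMap.opNorm_prod _ _).le.trans (max_le (n2.trans ?_) ?_)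
  · nlinarith [mul_nonneg hc1 hN0, mul_nonneg hc2 hN0]
  · refine (ContinuousLinearMap.opNorm_le_bound₂ _ (C := (3 * c1 + c2) * N) (by positivity)
      fun u v => ?_).trans (by nlinarith)
    rw [h.fderiv_fderiv_of_killing hV hVΩ hK hkill hy]
    have t1 : ‖fderiv ℝ K y (Γ y u v)‖ ≤ N * (c1 * ‖u‖ * ‖v‖) :=
      (ContinuousLinearMap.le_of_opNorm_le_of_le _ n2
        ((Γ y).le_of_opNorm₂_le_of_le h1.le le_rfl le_rfl))
    have t2 : ‖fderiv ℝ Γ y (K y) u v‖ ≤ c2 * N * ‖u‖ * ‖v‖ :=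
      (fderiv ℝ Γ y (K y)).le_of_opNorm₂_le_of_le
        (ContinuousLinearMap.le_of_opNorm_le_of_le _ h2.le n1) le_rfl le_rfl
    have t3 : ‖Γ y (fderiv ℝ K y u) v‖ ≤ c1 * (N * ‖u‖) * ‖v‖ :=
      (Γ y).le_of_opNorm₂_le_of_le h1.le
        (ContinuousLinearMap.le_of_opNorm_le_of_le _ n2 le_rfl) le_rfl
    have t4 : ‖Γ y u (fderiv ℝ K y v)‖ ≤ c1 * ‖u‖ * (N * ‖v‖) :=
      (Γ y).le_of_opNorm₂_le_of_le h1.le le_rfl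
        (ContinuousLinearMap.le_of_opNorm_le_of_le _ n2 le_rfl)
    calc _ ≤ ‖fderiv ℝ K y (Γ y u v)‖ + ‖fderiv ℝ Γ y (K y) u v‖ + ‖Γ y (fderiv ℝ K y u) v‖
          + ‖Γ y u (fderiv ℝ K y v)‖ :=
          norm_sub_le_of_le (norm_sub_le_of_le (norm_sub_le _ _) le_rfl) le_rfl
      _ ≤ N * (c1 * ‖u‖ * ‖v‖) + c2 * N * ‖u‖ * ‖v‖ + c1 * (N * ‖u‖) * ‖v‖
          + c1 * ‖u‖ * (N * ‖v‖) := by gcongr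
      _ = _ := by ring

end Uniqueness

/-! ### Connection and curvature of the Gödel-type metric. -/

namespace GodelType

section Christoffel

set_option synthInstance.maxHeartbeats 200000
set_option maxSynthPendingDepth 5

variable (M : GodelType)

theorem D_pos {x : ℝ} (hx : x ∈ M.I) : 0 < M.D x := Real.sqrt_pos.2 (M.lorentzian x hx)

theorem D_sq {x : ℝ} (hx : x ∈ M.I) : M.D x ^ 2 = M.G x + M.H x ^ 2 :=
  Real.sq_sqrt (M.lorentzian x hx).le

theorem smooth_D : ContDiffOn ℝ (⊤ : ℕ∞) M.D M.I :=
  (M.smooth_G.add (M.smooth_H.pow 2)).sqrt fun x hx => (M.lorentzian x hx).ne'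

theorem smooth_deriv_H : ContDiffOn ℝ (⊤ : ℕ∞) (deriv M.H) M.I :=
  ((contDiffOn_infty_iff_deriv_of_isOpen M.isOpen_I).1 M.smooth_H).2

theorem smooth_deriv_D : ContDiffOn ℝ (⊤ : ℕ∞) (deriv M.D) M.I :=
  ((contDiffOn_infty_iff_deriv_of_isOpen M.isOpen_I).1 M.smooth_D).2

variable {M} in
theorem hasDerivAt_of_smooth {f : ℝ → ℝ} (hf : ContDiffOn ℝ (⊤ : ℕ∞) f M.I) {x : ℝ}
    (hx : x ∈ M.I) : HasDerivAt f (deriv f x) x :=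
  ((hf.contDiffAt (M.isOpen_I.mem_nhds hx)).differentiableAt (by simp)).hasDerivAt

/-- Since `G = D² - H²`, all derivatives of the metric can be expressed through `H` and `D`, the
functions in which the curvature is simple. -/
theorem hasDerivAt_G {x : ℝ} (hx : x ∈ M.I) :
    HasDerivAt M.G (2 * M.D x * deriv M.D x - 2 * M.H x * deriv M.H x) x := by
  have h1 := ((hasDerivAt_of_smooth M.smooth_D hx).pow 2).sub
    ((hasDerivAt_of_smooth M.smooth_H hx).pow 2)
  have h2 : M.G =ᶠ[𝓝 x] M.D ^ 2 - M.H ^ 2 :=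
    Filter.eventually_of_mem (M.isOpen_I.mem_nhds hx) fun y hy => by
      simp [M.D_sq hy]
  refine (h1.congr_of_eventuallyEq h2).congr_deriv ?_
  simp

theorem isOpen_carrier : IsOpen M.carrier := M.isOpen_I.preimage (continuous_apply 1)

/-- The bilinear form `e^i ⊗ e^j`. -/
noncomputable def bilin (i j : Fin 5) : Coord5 →L[ℝ] Coord5 →L[ℝ] ℝ :=
  (ContinuousLinearMap.proj (R := ℝ) (φ := fun _ : Fin 5 => ℝ) i).smulRight
    (ContinuousLinearMap.proj (R := ℝ) (φ := fun _ : Fin 5 => ℝ) j)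

/-- The symmetric vector-valued bilinear map `(e^i ⊗ e^j + e^j ⊗ e^i) ⊗ e_k`. -/
noncomputable def trilin (i j k : Fin 5) : Coord5 →L[ℝ] Coord5 →L[ℝ] Coord5 :=
  (ContinuousLinearMap.proj (R := ℝ) (φ := fun _ : Fin 5 => ℝ) i).smulRight
    ((ContinuousLinearMap.proj (R := ℝ) (φ := fun _ : Fin 5 => ℝ) j).smulRight (Pi.single k 1))
  + (ContinuousLinearMap.proj (R := ℝ) (φ := fun _ : Fin 5 => ℝ) j).smulRight
    ((ContinuousLinearMap.proj (R := ℝ) (φ := fun _ : Fin 5 => ℝ) i).smulRight (Pi.single k 1))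

@[simp] theorem bilin_apply (i j : Fin 5) (v w : Coord5) : bilin i j v w = v i * w j := rfl

@[simp] theorem trilin_apply (i j k : Fin 5) (v w : Coord5) :
    trilin i j k v w = (v i * w j + v j * w i) • Pi.single k 1 := by
  simp [trilin, add_smul, mul_smul]

/-- The metric as a field of continuous bilinear forms. -/
noncomputable def metricL (p : Coord5) : Coord5 →L[ℝ] Coord5 →L[ℝ] ℝ :=
  bilin 0 0 + M.H (p 1) • (bilin 0 2 + bilin 2 0) - bilin 1 1 - M.G (p 1) • bilin 2 2
    - bilin 3 3 - bilin 4 4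

theorem metricL_apply (p v w : Coord5) : M.metricL p v w = M.metric p v w := by
  simp [metricL, metric, mul_add]

/-- The Christoffel symbol of the metric. -/
noncomputable def christoffel (p : Coord5) : Coord5 →L[ℝ] Coord5 →L[ℝ] Coord5 :=
  ((2 * M.D (p 1) * deriv M.D (p 1) - M.H (p 1) * deriv M.H (p 1)) / (2 * M.D (p 1) ^ 2)) •
    trilin 1 2 2
  + (-deriv M.H (p 1) / (2 * M.D (p 1) ^ 2)) • trilin 0 1 2
  + (((M.D (p 1) ^ 2 + M.H (p 1) ^ 2) * deriv M.H (p 1)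
      - 2 * M.H (p 1) * M.D (p 1) * deriv M.D (p 1)) / (2 * M.D (p 1) ^ 2)) • trilin 1 2 0
  + (M.H (p 1) * deriv M.H (p 1) / (2 * M.D (p 1) ^ 2)) • trilin 0 1 0
  + (deriv M.H (p 1) / 2) • trilin 0 2 1
  -- With equal indices `trilin` counts the product twice, hence the extra factor `1/2`.
  + ((M.H (p 1) * deriv M.H (p 1) - M.D (p 1) * deriv M.D (p 1)) / 2) • trilin 2 2 1

variable {M} in
theorem contDiffOn_comp_coord {f : ℝ → ℝ} (hf : ContDiffOn ℝ (⊤ : ℕ∞) f M.I) :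
    ContDiffOn ℝ (⊤ : ℕ∞) (fun p : Coord5 => f (p 1)) M.carrier :=
  hf.comp (contDiff_apply ℝ ℝ (1 : Fin 5)).contDiffOn fun _ hp => hp

variable {M} in
theorem hasFDerivAt_smul_const {W : Type*} [NormedAddCommGroup W] [NormedSpace ℝ W] {f : ℝ → ℝ}
    {f' : ℝ} {p : Coord5} (hf : HasDerivAt f f' (p 1)) (T : W) :
    HasFDerivAt (fun p : Coord5 => f (p 1) • T)
      ((f' • ContinuousLinearMap.proj (R := ℝ) (φ := fun _ : Fin 5 => ℝ) 1).smulRight T) p :=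
  (hf.comp_hasFDerivAt (x := p) (f := fun p : Coord5 => p 1)
    (hasFDerivAt_apply (1 : Fin 5) p)).smul_const T

theorem fderiv_metricL_apply {p : Coord5} (hp : p ∈ M.carrier) (u v w : Coord5) :
    fderiv ℝ M.metricL p u v w = u 1 * (deriv M.H (p 1) * (v 0 * w 2 + v 2 * w 0)
      - (2 * M.D (p 1) * deriv M.D (p 1) - 2 * M.H (p 1) * deriv M.H (p 1)) * (v 2 * w 2)) := by
  have h := ((((((hasFDerivAt_const (bilin 0 0) p).add (hasFDerivAt_smul_const
    (hasDerivAt_of_smooth M.smooth_H hp) (bilin 0 2 + bilin 2 0))).sub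
    (hasFDerivAt_const (bilin 1 1) p)).sub (hasFDerivAt_smul_const (M.hasDerivAt_G hp)
    (bilin 2 2))).sub (hasFDerivAt_const (bilin 3 3) p)).sub (hasFDerivAt_const (bilin 4 4) p))
  have h' : HasFDerivAt M.metricL _ p := h
  rw [h'.fderiv]
  simp
  ring

theorem contDiffOn_metricL : ContDiffOn ℝ (⊤ : ℕ∞) M.metricL M.carrier :=
  ((((contDiffOn_const.add ((contDiffOn_comp_coord M.smooth_H).smul contDiffOn_const)).sub
    contDiffOn_const).sub ((contDiffOn_comp_coord M.smooth_G).smul contDiffOn_const)).sub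
    contDiffOn_const).sub contDiffOn_const

theorem contDiffOn_christoffel : ContDiffOn ℝ (⊤ : ℕ∞) M.christoffel M.carrier := by
  have hH := contDiffOn_comp_coord M.smooth_H
  have hD := contDiffOn_comp_coord M.smooth_D
  have hH1 := contDiffOn_comp_coord M.smooth_deriv_H
  have hD1 := contDiffOn_comp_coord M.smooth_deriv_D
  have hne : ∀ p ∈ M.carrier, 2 * M.D (p 1) ^ 2 ≠ 0 := fun p hp => by
    have := M.D_pos hp
    positivity
  have hD2 := (contDiffOn_const (c := (2 : ℝ))).mul (hD.pow 2)
  refine (((((ContDiffOn.add ?_ ?_).add ?_).add ?_).add ?_).add ?_)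
  · exact ((((contDiffOn_const.mul hD).mul hD1).sub (hH.mul hH1)).div hD2 hne).smul contDiffOn_const
  · exact ((hH1.neg).div hD2 hne).smul contDiffOn_const
  · exact (((((hD.pow 2).add (hH.pow 2)).mul hH1).sub (((contDiffOn_const.mul hH).mul hD).mul
      hD1)).div hD2 hne).smul contDiffOn_const
  · exact ((hH.mul hH1).div hD2 hne).smul contDiffOn_const
  · exact (hH1.div_const _).smul contDiffOn_const
  · exact (((hH.mul hH1).sub (hD.mul hD1)).div_const _).smul contDiffOn_const

theorem isLeviCivita : IsLeviCivita M.metricL M.christoffel M.carrier where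
  isOpen := M.isOpen_carrier
  contDiffOn_metric := M.contDiffOn_metricL
  contDiffOn_christoffel := M.contDiffOn_christoffel
  symm p _ v w := by
    simp only [metricL_apply, metric]
    ring
  nondegenerate p hp v h := by
    have hD := M.D_pos hp
    have hD2 := M.D_sq hp
    simp only [metricL_apply, metric] at h
    have h0 := h (Pi.single 0 1)
    have h1 := h (Pi.single 1 1)
    have h2 := h (Pi.single 2 1)
    have h3 := h (Pi.single 3 1)
    have h4 := h (Pi.single 4 1)
    simp at h0 h1 h2 h3 h4
    -- The `t, y` block of the metric has determinant `-(G + H²) = -D²`; eliminating `v 0` leaves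
    -- this equation.
    have e2 : M.D (p 1) ^ 2 * v 2 = 0 := by
      rw [hD2]
      linear_combination M.H (p 1) * h0 - h2
    have e2' : v 2 = 0 := by simpa [hD.ne'] using e2
    rw [e2'] at h0
    ext i
    fin_cases i <;> simp_all
  torsionFree p _ v w := by
    ext i
    simp only [christoffel, add_apply, smul_apply, trilin_apply, Pi.add_apply, Pi.smul_apply,
      smul_eq_mul]
    ring
  compatible p hp u v w := by
    have hD := (M.D_pos hp).ne'
    have hG : M.G (p 1) = M.D (p 1) ^ 2 - M.H (p 1) ^ 2 := by rw [M.D_sq hp]; ring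
    rw [M.fderiv_metricL_apply hp]
    simp only [metricL_apply, metric, hG, christoffel, add_apply, smul_apply,
      trilin_apply, Pi.add_apply, Pi.smul_apply, smul_eq_mul]
    simp
    field_simp
    ring

/-- The coefficient `D''/D`. -/
noncomputable def baseCurv (x : ℝ) : ℝ := deriv (deriv M.D) x / M.D x

/-- The coefficient `H'/D`. -/
noncomputable def twist (x : ℝ) : ℝ := deriv M.H x / M.D x

theorem hasDerivAt_twist {x : ℝ} (hx : x ∈ M.I) :
    HasDerivAt M.twist ((deriv (deriv M.H) x * M.D x - deriv M.H x * deriv M.D x) / M.D x ^ 2) x :=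
  (hasDerivAt_of_smooth M.smooth_deriv_H hx).div (hasDerivAt_of_smooth M.smooth_D hx)
    (M.D_pos hx).ne'

/-- The Christoffel symbol in terms of `f = H'/D` and `s = D'/D`. -/
theorem christoffel_apply {p : Coord5} (hp : p ∈ M.carrier) {H D f s : ℝ} (hH : M.H (p 1) = H)
    (hD : M.D (p 1) = D) (hf : deriv M.H (p 1) = f * D) (hs : deriv M.D (p 1) = s * D)
    (v w : Coord5) :
    M.christoffel p v w = ![(D * f / 2 + H ^ 2 * f / (2 * D) - H * s) * (v 1 * w 2 + v 2 * w 1)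
        + H * f / (2 * D) * (v 0 * w 1 + v 1 * w 0),
      f * D / 2 * (v 0 * w 2 + v 2 * w 0) + (H * f * D - s * D ^ 2) * (v 2 * w 2),
      (s - H * f / (2 * D)) * (v 1 * w 2 + v 2 * w 1) - f / (2 * D) * (v 0 * w 1 + v 1 * w 0),
      0, 0] := by
  have hD0 : D ≠ 0 := hD ▸ (M.D_pos hp).ne'
  simp only [christoffel, add_apply, smul_apply, trilin_apply, hH, hD, hf, hs]
  ext i
  fin_cases i <;> simp <;> field_simp <;> ring

/-- Here `f'` stands for `(H'/D)'` and `m` for `D''/D`. With the values at `p` as free real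
parameters the claim is an identity of rational functions. -/
theorem fderiv_christoffel_apply {p : Coord5} (hp : p ∈ M.carrier) {H D f s f' m : ℝ}
    (hH : M.H (p 1) = H) (hD : M.D (p 1) = D) (hf : deriv M.H (p 1) = f * D)
    (hs : deriv M.D (p 1) = s * D) (hf' : deriv (deriv M.H) (p 1) = f' * D + f * s * D)
    (hm : deriv (deriv M.D) (p 1) = m * D) (u v w : Coord5) :
    fderiv ℝ M.christoffel p u v w = u 1 •
      ![(s * D * f / 2 + D * f' / 2 + H * f ^ 2 + H ^ 2 * f' / (2 * D) - H ^ 2 * f * s / (2 * D)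
          - f * D * s - H * (m - s ^ 2)) * (v 1 * w 2 + v 2 * w 1)
        + (f ^ 2 / 2 + H * f' / (2 * D) - H * f * s / (2 * D)) * (v 0 * w 1 + v 1 * w 0),
      (f' * D + f * s * D) / 2 * (v 0 * w 2 + v 2 * w 0)
        + (f ^ 2 * D ^ 2 + H * f' * D + H * f * s * D - (m + s ^ 2) * D ^ 2) * (v 2 * w 2),
      (m - s ^ 2 - f ^ 2 / 2 - H * f' / (2 * D) + H * f * s / (2 * D)) * (v 1 * w 2 + v 2 * w 1)
        - (f' - f * s) / (2 * D) * (v 0 * w 1 + v 1 * w 0),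
      0, 0] := by
  have hD0 := (M.D_pos hp).ne'
  have hne : 2 * M.D (p 1) ^ 2 ≠ 0 := by positivity
  have dH := hasDerivAt_of_smooth M.smooth_H hp
  have dD := hasDerivAt_of_smooth M.smooth_D hp
  have dH1 := hasDerivAt_of_smooth M.smooth_deriv_H hp
  have dD1 := hasDerivAt_of_smooth M.smooth_deriv_D hp
  have dD2 := (dD.pow 2).const_mul 2
  have k1 := hasFDerivAt_smul_const ((((dD.const_mul 2).mul dD1).sub (dH.mul dH1)).div dD2 hne)
    (trilin 1 2 2)
  have k2 := hasFDerivAt_smul_const (dH1.neg.div dD2 hne) (trilin 0 1 2)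
  have k3 := hasFDerivAt_smul_const (((((dD.pow 2).add (dH.pow 2)).mul dH1).sub
    (((dH.const_mul 2).mul dD).mul dD1)).div dD2 hne) (trilin 1 2 0)
  have k4 := hasFDerivAt_smul_const ((dH.mul dH1).div dD2 hne) (trilin 0 1 0)
  have k5 := hasFDerivAt_smul_const (dH1.div_const 2) (trilin 0 2 1)
  have k6 := hasFDerivAt_smul_const (((dH.mul dH1).sub (dD.mul dD1)).div_const 2) (trilin 2 2 1)
  have k : HasFDerivAt M.christoffel _ p := ((((k1.add k2).add k3).add k4).add k5).add k6
  have hT : ∀ (a : ℝ) (T : Coord5 →L[ℝ] Coord5 →L[ℝ] Coord5) (x y z : Coord5),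
      ((a • ContinuousLinearMap.proj (R := ℝ) (φ := fun _ : Fin 5 => ℝ) 1).smulRight T) x y z =
        (a * x 1) • T y z := fun a T x y z => by
    simp [ContinuousLinearMap.smulRight_apply]
  rw [k.fderiv]
  simp only [add_apply, hT, trilin_apply, hH, hD, hf, hs, hf', hm, Pi.mul_apply, Pi.sub_apply,
    Pi.add_apply, Pi.neg_apply, Pi.pow_apply]
  rw [hD] at hD0
  clear k k1 k2 k3 k4 k5 k6 hT dD2 dH dD dH1 dD1 hne hH hD hf hs hf' hm
  ext i
  fin_cases i <;> simp <;> field_simp <;> ring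

/-- The variables with indices 0 and 2 are components in the orthonormal coframe, and the `P`s are
components of `u ∧ v`. In this frame `D'/D` cancels and only `α`, `β`, `m` remain; the result is
then written back in coordinates. -/
theorem curvature_christoffel {p : Coord5} (hp : p ∈ M.carrier) (u v w : Coord5)
    {H D α β m u0 u2 v0 v2 w0 w2 P01 P02 P12 r0 r2 : ℝ} (hH : H = M.H (p 1)) (hD : D = M.D (p 1))
    (hα : α = M.twist (p 1) ^ 2 / 4) (hβ : β = deriv M.twist (p 1) / 2) (hm : m = M.baseCurv (p 1))
    (hu0 : u0 = u 0 + H * u 2) (hu2 : u2 = D * u 2) (hv0 : v0 = v 0 + H * v 2) (hv2 : v2 = D * v 2)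
    (hw0 : w0 = w 0 + H * w 2) (hw2 : w2 = D * w 2)
    (h01 : P01 = u0 * v 1 - u 1 * v0) (h02 : P02 = u0 * v2 - u2 * v0)
    (h12 : P12 = u 1 * v2 - u2 * v 1)
    (hr0 : r0 = -α * (P01 * w 1 + P02 * w2) + β * P12 * w 1)
    (hr2 : r2 = β * P01 * w 1 - α * P02 * w0 + (m - 3 * α) * P12 * w 1) :
    curvature M.christoffel p u v w = ![r0 - H * r2 / D,
      -α * P01 * w0 - β * P01 * w2 + β * P12 * w0 + (3 * α - m) * P12 * w2, r2 / D, 0, 0] := by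
  have hD0 : D ≠ 0 := hD ▸ (M.D_pos hp).ne'
  have hf : deriv M.H (p 1) = M.twist (p 1) * D := by rw [twist, ← hD]; field_simp
  have hs : deriv M.D (p 1) = deriv M.D (p 1) / D * D := by field_simp
  have hf' : deriv (deriv M.H) (p 1) =
      deriv M.twist (p 1) * D + M.twist (p 1) * (deriv M.D (p 1) / D) * D := by
    rw [(M.hasDerivAt_twist hp).deriv, twist, ← hD]
    field_simp
    ring
  have hm' : deriv (deriv M.D) (p 1) = m * D := by rw [hm, baseCurv, ← hD]; field_simp
  rw [curvature, M.fderiv_christoffel_apply hp hH.symm hD.symm hf hs hf' hm',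
    M.fderiv_christoffel_apply hp hH.symm hD.symm hf hs hf' hm',
    M.christoffel_apply hp hH.symm hD.symm hf hs, M.christoffel_apply hp hH.symm hD.symm hf hs,
    M.christoffel_apply hp hH.symm hD.symm hf hs, M.christoffel_apply hp hH.symm hD.symm hf hs]
  clear hf hs hf' hm' hH hD hm hp
  generalize deriv M.D (p 1) / D = s at *
  generalize M.twist (p 1) = f at *
  generalize deriv M.twist (p 1) = f' at *
  subst hr0 hr2 h01 h02 h12 hu0 hu2 hv0 hv2 hw0 hw2 hα hβ
  ext i
  fin_cases i
  · simp
    field_simp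
    ring
  · simp
    field_simp
    ring
  · simp
    field_simp
    ring
  · simp
  · simp

end Christoffel

end GodelType

/-! ### Ricci endomorphism and constancy of the parameters. -/

/-- The curvature operator `u ↦ R(u, v)w`. -/
noncomputable def curvatureOperator {E : Type*} [NormedAddCommGroup E] [NormedSpace ℝ E]
    (Γ : E → E →L[ℝ] E →L[ℝ] E) (p v w : E) : E →ₗ[ℝ] E where
  toFun u := curvature Γ p u v w
  map_add' a b := by simp only [curvature, map_add, add_apply]; abel
  map_smul' c a := by
    simp only [curvature, map_smul, smul_apply, RingHom.id_apply]
    module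

/-- A continuous function on a preconnected set that takes only finitely many values is
constant. -/
theorem IsPreconnected.eq_of_finite_range {s t : Set ℝ} (hs : IsPreconnected s) {f : ℝ → ℝ}
    (hf : ContinuousOn f s) (ht : t.Finite) (hmaps : Set.MapsTo f s t) {x y : ℝ} (hx : x ∈ s)
    (hy : y ∈ s) : f x = f y := by
  by_contra hne
  exact ((hs.image f hf).infinite_of_nontrivial
    ⟨f x, Set.mem_image_of_mem f hx, f y, Set.mem_image_of_mem f hy, hne⟩)
    (ht.subset hmaps.image_subset)

namespace GodelType

section Ricci

variable (M : GodelType)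

/-- The Ricci endomorphism of the metric. -/
noncomputable def ricciEndo (p : Coord5) : Coord5 →ₗ[ℝ] Coord5 where
  toFun v :=
    ![(M.twist (p 1) ^ 2 / 2) * (v 0 + M.H (p 1) * v 2)
        + deriv M.twist (p 1) / 2 * (M.D (p 1) * v 2)
        + M.H (p 1) * ((deriv M.twist (p 1) / 2 * (v 0 + M.H (p 1) * v 2)
          + (M.twist (p 1) ^ 2 / 2 - M.baseCurv (p 1)) * (M.D (p 1) * v 2)) / M.D (p 1)),
      -(M.twist (p 1) ^ 2 / 2 - M.baseCurv (p 1)) * v 1,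
      -(deriv M.twist (p 1) / 2 * (v 0 + M.H (p 1) * v 2)
        + (M.twist (p 1) ^ 2 / 2 - M.baseCurv (p 1)) * (M.D (p 1) * v 2)) / M.D (p 1), 0, 0]
  map_add' v w := by
    ext i
    fin_cases i <;> simp <;> ring
  map_smul' c v := by
    ext i
    fin_cases i <;> simp <;> ring

theorem ricciEndo_apply (p v : Coord5) : M.ricciEndo p v =
    ![(M.twist (p 1) ^ 2 / 2) * (v 0 + M.H (p 1) * v 2)
        + deriv M.twist (p 1) / 2 * (M.D (p 1) * v 2)
        + M.H (p 1) * ((deriv M.twist (p 1) / 2 * (v 0 + M.H (p 1) * v 2)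
          + (M.twist (p 1) ^ 2 / 2 - M.baseCurv (p 1)) * (M.D (p 1) * v 2)) / M.D (p 1)),
      -(M.twist (p 1) ^ 2 / 2 - M.baseCurv (p 1)) * v 1,
      -(deriv M.twist (p 1) / 2 * (v 0 + M.H (p 1) * v 2)
        + (M.twist (p 1) ^ 2 / 2 - M.baseCurv (p 1)) * (M.D (p 1) * v 2)) / M.D (p 1), 0, 0] := rfl

theorem trace_eq_sum (f : Coord5 →ₗ[ℝ] Coord5) :
    LinearMap.trace ℝ Coord5 f = ∑ i, f (Pi.single i 1) i := by
  rw [LinearMap.trace_eq_matrix_trace ℝ (Pi.basisFun ℝ (Fin 5)), Matrix.trace]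
  simp

/-- This identifies the explicit `ricciEndo` with the Ricci tensor, one index raised by the metric,
and so makes it natural under isometries. -/
theorem trace_curvatureOperator {p : Coord5} (hp : p ∈ M.carrier) (v w : Coord5) :
    LinearMap.trace ℝ Coord5 (curvatureOperator M.christoffel p v w) =
      M.metric p (M.ricciEndo p v) w := by
  have hD := (M.D_pos hp).ne'
  have hG : M.G (p 1) = M.D (p 1) ^ 2 - M.H (p 1) ^ 2 := by rw [M.D_sq hp]; ring
  have hR : ∀ u, curvatureOperator M.christoffel p v w u = _ := fun u =>
    M.curvature_christoffel hp u v w rfl rfl rfl rfl rfl rfl rfl rfl rfl rfl rfl rfl rfl rfl rfl rfl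
  simp only [trace_eq_sum, hR, Fin.sum_univ_five, metric, ricciEndo_apply, hG]
  simp
  field_simp
  ring

theorem trace_ricciEndo {p : Coord5} (hp : p ∈ M.carrier) :
    LinearMap.trace ℝ Coord5 (M.ricciEndo p) =
      2 * M.baseCurv (p 1) - M.twist (p 1) ^ 2 / 2 := by
  have hD := (M.D_pos hp).ne'
  simp only [trace_eq_sum, Fin.sum_univ_five, ricciEndo_apply]
  simp
  field_simp
  ring

/-- The derivative of `H'/D` couples only the directions dual to `dt + H dy` and `D dy`, so `∂_x`
stays an eigenvector even before that derivative is known to vanish. -/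
theorem hasEigenvalue_ricciEndo (p : Coord5) :
    Module.End.HasEigenvalue (M.ricciEndo p) (M.baseCurv (p 1) - M.twist (p 1) ^ 2 / 2) := by
  refine Module.End.hasEigenvalue_of_hasEigenvector (x := Pi.single 1 1)
    ⟨Module.End.mem_eigenspace_iff.2 ?_, fun h => ?_⟩
  · rw [ricciEndo_apply]
    ext i
    fin_cases i <;> simp
  · simpa using congrFun h 1

/-- A local isometry conjugates the Ricci endomorphisms. -/
theorem IsLocalIsometry.exists_conj {M : GodelType} {φ : OpenPartialHomeomorph Coord5 Coord5}
    (hφ : M.IsLocalIsometry φ) {p : Coord5} (hp : p ∈ φ.source) :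
    ∃ e : Coord5 ≃ₗ[ℝ] Coord5, M.ricciEndo (φ p) = e.conj (M.ricciEndo p) := by
  have hLC := M.isLeviCivita
  have hmaps : Set.MapsTo φ φ.source M.carrier := fun x hx => hφ.target_subset (φ.map_source hx)
  have hiso : ∀ q ∈ φ.source, ∀ v w, M.metricL (φ q) (fderiv ℝ φ q v) (fderiv ℝ φ q w) =
      M.metricL q v w := fun q hq v w => by
    simpa only [metricL_apply] using hφ.isometry q hq v w
  have hinj : ∀ q ∈ φ.source, Function.Injective (fderiv ℝ φ q : Coord5 →ₗ[ℝ] Coord5) :=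
    fun q hq => (injective_iff_map_eq_zero _).2 fun v hv =>
      hLC.nondegenerate q (hφ.source_subset hq) v fun w => by
        rw [← hiso q hq, show fderiv ℝ φ q v = 0 from hv]
        simp
  have hsurj : ∀ q ∈ φ.source, Function.Surjective (fderiv ℝ φ q) := fun q hq =>
    LinearMap.surjective_of_injective (hinj q hq)
  set e := LinearEquiv.ofInjectiveEndo _ (hinj p hp) with he
  have hcoe : ∀ v, e v = fderiv ℝ φ p v := fun v => rfl
  have hcurv := hLC.curvature_of_isometry φ.open_source hφ.source_subset hφ.smooth hmaps hiso
    hsurj hp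
  -- The derivative of `φ` conjugates the curvature operators, and the trace does not see
  -- conjugation. Nondegeneracy of the metric later passes from the Ricci tensor to the
  -- endomorphism.
  have htr : ∀ v w, M.metricL (φ p) (M.ricciEndo (φ p) (e v)) (e w) =
      M.metricL p (M.ricciEndo p v) w := fun v w => by
    rw [metricL_apply, metricL_apply, ← M.trace_curvatureOperator (hmaps hp),
      ← M.trace_curvatureOperator (hφ.source_subset hp),
      ← LinearMap.trace_conj' (curvatureOperator M.christoffel p v w) e]
    congr 1
    refine LinearMap.ext fun u => ?_
    obtain ⟨u, rfl⟩ := e.surjective u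
    rw [LinearEquiv.conj_apply_apply, LinearEquiv.symm_apply_apply, hcoe u, hcoe v, hcoe w]
    exact (hcurv u v w).symm
  refine ⟨e, LinearMap.ext fun v => ?_⟩
  obtain ⟨v, rfl⟩ := e.surjective v
  rw [LinearEquiv.conj_apply_apply, LinearEquiv.symm_apply_apply, ← sub_eq_zero]
  refine hLC.nondegenerate _ (hmaps hp) _ fun w => ?_
  obtain ⟨w, rfl⟩ := e.surjective w
  rw [map_sub, sub_apply, htr, hcoe (M.ricciEndo p v), hcoe w, hiso p hp, sub_self]

theorem continuousOn_twist : ContinuousOn M.twist M.I :=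
  M.smooth_deriv_H.continuousOn.div M.smooth_D.continuousOn fun _ hx => (M.D_pos hx).ne'

theorem continuousOn_baseCurv : ContinuousOn M.baseCurv M.I :=
  (((contDiffOn_infty_iff_deriv_of_isOpen M.isOpen_I).1 M.smooth_deriv_D).2).continuousOn.div
    M.smooth_D.continuousOn fun _ hx => (M.D_pos hx).ne'

/-- On a locally homogeneous space `H'/D` and `D''/D` are constant. -/
theorem IsLocallyHomogeneous.exists_hasParameters {M : GodelType} (hM : M.IsLocallyHomogeneous) :
    ∃ m2 ω : ℝ, M.HasParameters m2 ω := by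
  obtain ⟨x0, hx0⟩ := M.isConnected_I.nonempty
  have hpre := M.isConnected_I.isPreconnected
  set q : Coord5 := fun _ => x0
  have key : ∀ x ∈ M.I,
      Module.End.HasEigenvalue (M.ricciEndo q) (M.baseCurv x - M.twist x ^ 2 / 2) ∧
      2 * M.baseCurv x - M.twist x ^ 2 / 2 = 2 * M.baseCurv x0 - M.twist x0 ^ 2 / 2 := by
    intro x hx
    have hp : (fun _ => x : Coord5) ∈ M.carrier := hx
    obtain ⟨φ, hφ, hps, hφp⟩ := hM _ hp q hx0
    obtain ⟨e, he⟩ := hφ.exists_conj hps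
    rw [hφp] at he
    constructor
    · obtain ⟨v, hv⟩ := (M.hasEigenvalue_ricciEndo fun _ => x).exists_hasEigenvector
      refine Module.End.hasEigenvalue_of_hasEigenvector (x := e v)
        ⟨Module.End.mem_eigenspace_iff.2 ?_, fun h => hv.2 (e.map_eq_zero_iff.1 h)⟩
      rw [he, LinearEquiv.conj_apply_apply, LinearEquiv.symm_apply_apply, hv.apply_eq_smul,
        map_smul]
    · have h1 := M.trace_ricciEndo (p := q) hx0
      rw [he, LinearMap.trace_conj', M.trace_ricciEndo hp] at h1
      exact h1
  have hcont : ContinuousOn (fun x => M.baseCurv x - M.twist x ^ 2 / 2) M.I :=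
    M.continuousOn_baseCurv.sub ((M.continuousOn_twist.pow 2).div_const 2)
  -- All values lie in the finite spectrum of one fixed endomorphism, the Ricci endomorphism at `q`.
  have hρ : ∀ x ∈ M.I, M.baseCurv x - M.twist x ^ 2 / 2 = M.baseCurv x0 - M.twist x0 ^ 2 / 2 :=
    fun x hx => hpre.eq_of_finite_range hcont (Module.End.finite_hasEigenvalue (M.ricciEndo q))
      (fun y hy => (key y hy).1) hx hx0
  -- The trace minus the eigenvalue is `D''/D`.
  have hm : ∀ x ∈ M.I, M.baseCurv x = M.baseCurv x0 := fun x hx => by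
    linarith [hρ x hx, (key x hx).2]
  have hf : ∀ x ∈ M.I, M.twist x = M.twist x0 := fun x hx => by
    refine hpre.eq_of_finite_range M.continuousOn_twist
      (Set.toFinite {M.twist x0, -M.twist x0}) (fun y hy => ?_) hx hx0
    exact sq_eq_sq_iff_eq_or_eq_neg.1 (by linarith [hρ y hy, hm y hy])
  refine ⟨M.baseCurv x0, -M.twist x0 / 2, fun x hx => ⟨?_, hm x hx⟩⟩
  rw [show -2 * (-M.twist x0 / 2) = M.twist x0 by ring]
  exact hf x hx

end Ricci

end GodelType

/-! ### The isotropy algebra of the curvature tensor. -/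

namespace GodelType

section Isotropy

variable (M : GodelType)

/-- The components of a vector in the orthonormal coframe `dt + H dy, dx, D dy, dz, du`. -/
noncomputable def coframe (p : Coord5) : Coord5 →ₗ[ℝ] Coord5 where
  toFun v := ![v 0 + M.H (p 1) * v 2, v 1, M.D (p 1) * v 2, v 3, v 4]
  map_add' v w := by
    ext i
    fin_cases i <;> simp <;> ring
  map_smul' c v := by
    ext i
    fin_cases i <;> simp <;> ring

/-- The orthonormal frame dual to `coframe`. -/
noncomputable def frame (p : Coord5) : Fin 5 → Coord5 :=
  ![![1, 0, 0, 0, 0], ![0, 1, 0, 0, 0], ![-M.H (p 1) / M.D (p 1), 0, 1 / M.D (p 1), 0, 0],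
    ![0, 0, 0, 1, 0], ![0, 0, 0, 0, 1]]

theorem coframe_apply (p v : Coord5) :
    M.coframe p v = ![v 0 + M.H (p 1) * v 2, v 1, M.D (p 1) * v 2, v 3, v 4] := rfl

theorem coframe_frame {p : Coord5} (hp : p ∈ M.carrier) (i : Fin 5) :
    M.coframe p (M.frame p i) = Pi.single i 1 := by
  have hD := (M.D_pos hp).ne'
  ext j
  fin_cases i <;> fin_cases j <;> (simp [coframe_apply, frame] <;> (try field_simp) <;> (try simp))

theorem sum_coframe_smul_frame {p : Coord5} (hp : p ∈ M.carrier) (v : Coord5) :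
    v = ∑ i, M.coframe p v i • M.frame p i := by
  have hD := (M.D_pos hp).ne'
  rw [Fin.sum_univ_five]
  ext j
  fin_cases j <;> simp [coframe_apply, frame] <;> field_simp
  ring

theorem coframe_injective {p : Coord5} (hp : p ∈ M.carrier) :
    Function.Injective (M.coframe p) := fun v w h => by
  rw [M.sum_coframe_smul_frame hp v, h, ← M.sum_coframe_smul_frame hp w]

theorem metric_eq_coframe {p : Coord5} (hp : p ∈ M.carrier) (v w : Coord5) :
    M.metric p v w = M.coframe p v 0 * M.coframe p w 0 - M.coframe p v 1 * M.coframe p w 1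
      - M.coframe p v 2 * M.coframe p w 2 - M.coframe p v 3 * M.coframe p w 3
      - M.coframe p v 4 * M.coframe p w 4 := by
  have hG : M.G (p 1) = M.D (p 1) ^ 2 - M.H (p 1) ^ 2 := by rw [M.D_sq hp]; ring
  simp only [metric, hG, coframe_apply]
  simp
  ring

variable {M} {m2 ω : ℝ}

/-- Constancy of `H'/D = -2ω` gives `β = 0` and `α = ω²`. Only the coefficients `ω²` and `m² - 3ω²`
remain, and the `z, u` directions drop out. -/
theorem HasParameters.curvature (h : M.HasParameters m2 ω) {p : Coord5} (hp : p ∈ M.carrier)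
    (u v w : Coord5) {a b c r : Coord5} (ha : a = M.coframe p u) (hb : b = M.coframe p v)
    (hc : c = M.coframe p w) (hr : r = M.coframe p (curvature M.christoffel p u v w)) :
    r = ![-ω ^ 2 * ((a 0 * b 1 - a 1 * b 0) * c 1 + (a 0 * b 2 - a 2 * b 0) * c 2),
      -ω ^ 2 * (a 0 * b 1 - a 1 * b 0) * c 0 + (3 * ω ^ 2 - m2) * (a 1 * b 2 - a 2 * b 1) * c 2,
      -ω ^ 2 * (a 0 * b 2 - a 2 * b 0) * c 0 + (m2 - 3 * ω ^ 2) * (a 1 * b 2 - a 2 * b 1) * c 1,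
      0, 0] := by
  have hD := (M.D_pos hp).ne'
  have ht : M.twist (p 1) = -2 * ω := (h _ hp).1
  have ht' : deriv M.twist (p 1) = 0 := by
    have : M.twist =ᶠ[𝓝 (p 1)] fun _ => -2 * ω :=
      Filter.eventually_of_mem (M.isOpen_I.mem_nhds hp) fun x hx => (h x hx).1
    rw [this.deriv_eq, deriv_const]
  have hm : M.baseCurv (p 1) = m2 := (h _ hp).2
  rw [hr, M.curvature_christoffel hp u v w rfl rfl rfl rfl rfl rfl rfl rfl rfl rfl rfl rfl rfl rfl
    rfl rfl, ht, ht', hm, ha, hb, hc]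
  ext i
  fin_cases i <;> simp [coframe_apply] <;> field_simp <;> ring

variable (M) in
/-- The isotropy algebra of the curvature at `p`: the endomorphisms of the tangent space at `p`
that are skew for the metric and act trivially on the curvature tensor. -/
def IsIsotropy (p : Coord5) (A : Coord5 →L[ℝ] Coord5) : Prop :=
  (∀ v w, M.metric p (A v) w + M.metric p v (A w) = 0) ∧
  ∀ u v w, A (_root_.curvature M.christoffel p u v w) = _root_.curvature M.christoffel p (A u) v w
    + _root_.curvature M.christoffel p u (A v) w + _root_.curvature M.christoffel p u v (A w)

variable (M) in
/-- The matrix of an endomorphism in the orthonormal frame. -/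
noncomputable def frameMatrix (p : Coord5) (A : Coord5 →L[ℝ] Coord5) (i j : Fin 5) : ℝ :=
  M.coframe p (A (M.frame p j)) i

variable {p : Coord5} {A : Coord5 →L[ℝ] Coord5}

theorem eq_zero_of_frameMatrix (hp : p ∈ M.carrier) (h : ∀ i j, M.frameMatrix p A i j = 0) :
    A = 0 := by
  ext1 v
  rw [M.sum_coframe_smul_frame hp v, map_sum]
  refine Finset.sum_eq_zero fun j _ => ?_
  rw [map_smul, M.coframe_injective hp (a₁ := A (M.frame p j)) (a₂ := 0) ?_, smul_zero]
  rw [map_zero]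
  ext i
  exact h i j

theorem IsIsotropy.skew (hA : M.IsIsotropy p A) (hp : p ∈ M.carrier) :
    (∀ i, M.frameMatrix p A i i = 0) ∧ (∀ i, i ≠ 0 → M.frameMatrix p A 0 i = M.frameMatrix p A i 0)
      ∧ ∀ i j, i ≠ 0 → j ≠ 0 → M.frameMatrix p A i j = -M.frameMatrix p A j i := by
  have key := fun i j => hA.1 (M.frame p i) (M.frame p j)
  simp only [M.metric_eq_coframe hp, M.coframe_frame hp] at key
  refine ⟨fun i => ?_, fun i hi => ?_, fun i j hi hj => ?_⟩
  · have := key i i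
    fin_cases i <;> simp at this <;> simpa [frameMatrix] using this
  · have := key 0 i
    fin_cases i <;> simp at this hi <;> simp [frameMatrix] <;> linarith
  · have := key i j
    fin_cases i <;> fin_cases j <;> simp at this hi hj <;> simp [frameMatrix] <;> linarith

/-- All curvature operators `R(u, v)` annihilate the frame vector `e_k`, so by invariance they
annihilate `A e_k`. Its components along `t, x, y` are thus killed by the curvature coefficients. -/
theorem IsIsotropy.frameMatrix_flat (hA : M.IsIsotropy p A) (h : M.HasParameters m2 ω)
    (hp : p ∈ M.carrier) {k : Fin 5} (hk : k = 3 ∨ k = 4) :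
    ω ^ 2 * M.frameMatrix p A 0 k = 0 ∧ ω ^ 2 * M.frameMatrix p A 1 k = 0 ∧
      ω ^ 2 * M.frameMatrix p A 2 k = 0 ∧ (m2 - 3 * ω ^ 2) * M.frameMatrix p A 1 k = 0 ∧
      (m2 - 3 * ω ^ 2) * M.frameMatrix p A 2 k = 0 := by
  have key : ∀ i j l, M.coframe p (_root_.curvature M.christoffel p (M.frame p i) (M.frame p j)
      (A (M.frame p k))) l = 0 := by
    have h0 : ∀ u v, _root_.curvature M.christoffel p u v (M.frame p k) = 0 := fun u v => by
      refine M.coframe_injective hp ?_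
      rw [h.curvature hp u v (M.frame p k) rfl rfl rfl rfl, M.coframe_frame hp, map_zero]
      rcases hk with rfl | rfl <;> ext i <;> fin_cases i <;> simp
    intro i j l
    have := hA.2 (M.frame p i) (M.frame p j) (M.frame p k)
    rw [h0, h0, h0, map_zero, zero_add, zero_add] at this
    rw [← this, map_zero, Pi.zero_apply]
  simp only [fun u v w => h.curvature hp u v w rfl rfl rfl rfl, M.coframe_frame hp] at key
  have k1 := key 0 1 1
  have k2 := key 0 1 0
  have k3 := key 0 2 0
  have k4 := key 1 2 2
  have k5 := key 1 2 1
  simp at k1 k2 k3 k4 k5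
  simp only [frameMatrix]
  refine ⟨?_, ?_, ?_, ?_, ?_⟩ <;> simp
  · exact k1
  · exact k2
  · exact k3
  · exact k4
  · rcases k5 with k5 | k5
    · left; linarith
    · right; exact k5

/-- Applying `A` to `R(e₀, e₁)e₂ = 0` and `R(e₀, e₂)e₁ = 0` compares the coefficients `m² - 3ω²` and
`ω²`. They agree exactly when the `t, x, y` part has constant curvature. -/
theorem IsIsotropy.frameMatrix_time (hA : M.IsIsotropy p A) (h : M.HasParameters m2 ω)
    (hp : p ∈ M.carrier) :
    (m2 - 4 * ω ^ 2) * M.frameMatrix p A 1 0 = 0 ∧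
      (m2 - 4 * ω ^ 2) * M.frameMatrix p A 2 0 = 0 := by
  obtain ⟨s1, s2, s3⟩ := hA.skew hp
  have h0 : ∀ i j k l, (i = 0 ∧ j = 1 ∧ k = 2) ∨ (i = 0 ∧ j = 2 ∧ k = 1) →
      M.coframe p (_root_.curvature M.christoffel p (A (M.frame p i)) (M.frame p j) (M.frame p k)) l
      + M.coframe p
        (_root_.curvature M.christoffel p (M.frame p i) (A (M.frame p j)) (M.frame p k)) l
      + M.coframe p
        (_root_.curvature M.christoffel p (M.frame p i) (M.frame p j) (A (M.frame p k))) l = 0 := by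
    intro i j k l hijk
    have h1 : _root_.curvature M.christoffel p (M.frame p i) (M.frame p j) (M.frame p k) = 0 := by
      refine M.coframe_injective hp ?_
      rw [h.curvature hp _ _ _ rfl rfl rfl rfl]
      simp only [M.coframe_frame hp, map_zero]
      rcases hijk with ⟨rfl, rfl, rfl⟩ | ⟨rfl, rfl, rfl⟩ <;> ext i <;> fin_cases i <;> simp
    have := congrFun (congrArg (M.coframe p) (hA.2 (M.frame p i) (M.frame p j) (M.frame p k))) l
    rw [h1] at this
    simp only [map_zero, map_add, Pi.add_apply, Pi.zero_apply] at this
    exact this.symm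
  have k1 := h0 0 1 2 1 (by simp)
  have k2 := h0 0 2 1 2 (by simp)
  simp only [fun u v w => h.curvature hp u v w rfl rfl rfl rfl, M.coframe_frame hp] at k1 k2
  simp at k1 k2
  have e1 := s2 1 (by decide)
  have e2 := s2 2 (by decide)
  simp only [frameMatrix] at *
  rw [e1] at k2
  rw [e2] at k1
  constructor <;> linarith

/-- Vanishing of an isotropy from the vanishing of some entries of its matrix. -/
theorem IsIsotropy.eq_zero (hA : M.IsIsotropy p A) (hp : p ∈ M.carrier)
    (h10 : M.frameMatrix p A 1 0 = 0) (h20 : M.frameMatrix p A 2 0 = 0)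
    (h12 : M.frameMatrix p A 1 2 = 0) (h34 : M.frameMatrix p A 3 4 = 0)
    (h3 : ∀ i, i = 0 ∨ i = 1 ∨ i = 2 → M.frameMatrix p A i 3 = 0)
    (h4 : ∀ i, i = 0 ∨ i = 1 ∨ i = 2 → M.frameMatrix p A i 4 = 0) : A = 0 := by
  obtain ⟨s1, s2, s3⟩ := hA.skew hp
  refine eq_zero_of_frameMatrix hp fun i j => ?_
  have a1 := s2 1 (by decide)
  have a2 := s2 2 (by decide)
  have a3 := s2 3 (by decide)
  have a4 := s2 4 (by decide)
  have b1 := s3 2 1 (by decide) (by decide)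
  have b2 := s3 3 1 (by decide) (by decide)
  have b3 := s3 4 1 (by decide) (by decide)
  have b4 := s3 3 2 (by decide) (by decide)
  have b5 := s3 4 2 (by decide) (by decide)
  have b6 := s3 4 3 (by decide) (by decide)
  have c0 := h3 0 (by simp)
  have c1 := h3 1 (by simp)
  have c2 := h3 2 (by simp)
  have d0 := h4 0 (by simp)
  have d1 := h4 1 (by simp)
  have d2 := h4 2 (by simp)
  fin_cases i <;> fin_cases j <;> first | exact s1 _ | (simp; linarith)

end Isotropy

end GodelType

/-! ### Counting Killing fields by their jets at a point. -/

namespace GodelType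

section Rank

variable {M : GodelType} {m2 ω : ℝ}

theorem lieDerivMetric_eq {K : Coord5 → Coord5} {p : Coord5} (hp : p ∈ M.carrier) (v w : Coord5) :
    M.lieDerivMetric K p v w = fderiv ℝ M.metricL p (K p) v w
      + M.metricL p (fderiv ℝ K p v) w + M.metricL p v (fderiv ℝ K p w) := by
  have h1 := ((M.isLeviCivita.differentiableAt_metric hp).hasFDerivAt.clm_apply
    (hasFDerivAt_const v p)).clm_apply (hasFDerivAt_const w p)
  have h2 : (fun q => M.metric q v w) = fun q => M.metricL q v w := by
    ext q
    rw [metricL_apply]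
  rw [lieDerivMetric, h2, h1.fderiv]
  simp [metricL_apply]

theorem killingOn_anti {U V : Set Coord5} (h : U ⊆ V) : M.killingOn V ≤ M.killingOn U :=
  fun _ hK p hp => hK p (h hp)

theorem differentiableAt_of_mem_killingOn {U : Set Coord5} {K : Coord5 → Coord5}
    (hK : K ∈ M.killingOn U) {p : Coord5} (hp : p ∈ U) : DifferentiableAt ℝ K p :=
  (hK p hp).1.differentiableAt (by simp)

theorem isIsotropy_of_killing {U : Set Coord5} (hU : IsOpen U) (hUM : U ⊆ M.carrier)
    {K : Coord5 → Coord5} (hK : K ∈ M.killingOn U) {p : Coord5} (hp : p ∈ U) (hKp : K p = 0) :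
    M.IsIsotropy p (fderiv ℝ K p) := by
  refine ⟨fun v w => ?_, fun u v w => M.isLeviCivita.curvature_of_killing hU hUM
    (fun x hx => (hK x hx).1.contDiffWithinAt) (fun x hx v w => ?_) hp hKp u v w⟩
  · have := (hK p hp).2 v w
    rw [lieDerivMetric_eq (hUM hp), hKp] at this
    simpa [metricL_apply] using this
  · rw [← lieDerivMetric_eq (hUM hx)]
    exact (hK x hx).2 v w

theorem eq_zero_of_killing {U : Set Coord5} (hU : IsOpen U) (hUc : IsConnected U)
    (hUM : U ⊆ M.carrier) {K : Coord5 → Coord5} (hK : K ∈ M.killingOn U) {p : Coord5}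
    (hp : p ∈ U) (hKp : K p = 0) (hdKp : fderiv ℝ K p = 0) : ∀ x ∈ U, K x = 0 :=
  M.isLeviCivita.killing_eq_zero hU hUc.isPreconnected hUM
    (fun x hx => (hK x hx).1.contDiffWithinAt) (fun x hx v w => by
      rw [← lieDerivMetric_eq (hUM hx)]
      exact (hK x hx).2 v w) hp hKp hdKp

/-- The value at `p` of a Killing vector field, together with some of the entries of the matrix of
its derivative in the orthonormal frame. -/
noncomputable def jet {U : Set Coord5} {p : Coord5} (hp : p ∈ U) {k : ℕ}
    (idx : Fin k → Fin 5 × Fin 5) : M.killingOn U →ₗ[ℝ] Coord5 × (Fin k → ℝ) where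
  toFun K := (K.1 p, fun i => M.frameMatrix p (fderiv ℝ K.1 p) (idx i).1 (idx i).2)
  map_add' K L := by
    have h : fderiv ℝ (K.1 + L.1) p = fderiv ℝ K.1 p + fderiv ℝ L.1 p :=
      fderiv_add (differentiableAt_of_mem_killingOn K.2 hp)
        (differentiableAt_of_mem_killingOn L.2 hp)
    ext i
    · simp
    · simp [frameMatrix, h]
  map_smul' c K := by
    have h : fderiv ℝ (c • K.1) p = c • fderiv ℝ K.1 p :=
      fderiv_const_smul (differentiableAt_of_mem_killingOn K.2 hp) c
    ext i
    · simp
    · simp [frameMatrix, h]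

theorem jet_apply {U : Set Coord5} {p : Coord5} (hp : p ∈ U) {k : ℕ}
    (idx : Fin k → Fin 5 × Fin 5) (K : M.killingOn U) : jet hp idx K =
      (K.1 p, fun i => M.frameMatrix p (fderiv ℝ K.1 p) (idx i).1 (idx i).2) := rfl

/-- The dimension of the space of Killing vector fields is the dimension of the tangent space plus
that of the isotropy algebra, if there are Killing vector fields enough. -/
theorem rank_killingFields {U : Set Coord5} (hU : IsOpen U) (hUc : IsConnected U)
    (hUM : U ⊆ M.carrier) {p : Coord5} (hp : p ∈ U) {k : ℕ} (idx : Fin k → Fin 5 × Fin 5)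
    (hidx : ∀ A, M.IsIsotropy p A → (∀ i, M.frameMatrix p A (idx i).1 (idx i).2 = 0) → A = 0)
    (hJ : Function.Surjective (jet (M := M) hp idx)) :
    Module.rank ℝ (M.killingFields U) = (5 + k : ℕ) := by
  -- Elements of `killingOn U` are arbitrary off `U`, so only the quotient by fields vanishing on
  -- `U` has the wanted dimension. The jet map has the same kernel as restriction to `U`, hence both
  -- images are isomorphic.
  have hker : LinearMap.ker (jet (M := M) hp idx) = LinearMap.ker
      ((LinearMap.funLeft ℝ Coord5 (Subtype.val : U → Coord5)).domRestrict (M.killingOn U)) := by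
    ext K
    rw [LinearMap.mem_ker, LinearMap.mem_ker, jet_apply, Prod.mk_eq_zero]
    constructor
    · rintro ⟨h0, h1⟩
      have := eq_zero_of_killing hU hUc hUM K.2 hp h0
        (hidx _ (isIsotropy_of_killing hU hUM K.2 hp h0) (congrFun h1))
      ext1 x
      exact this x x.2
    · intro h
      have h0 : ∀ x ∈ U, K.1 x = 0 := fun x hx => congrFun h ⟨x, hx⟩
      have h1 : fderiv ℝ K.1 p = 0 := by
        have : K.1 =ᶠ[𝓝 p] fun _ => 0 := Filter.eventually_of_mem (hU.mem_nhds hp) h0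
        rw [this.fderiv_eq]
        simp
      refine ⟨h0 p hp, ?_⟩
      ext i
      simp [h1, frameMatrix]
  have e1 := (jet (M := M) hp idx).quotKerEquivOfSurjective hJ
  have e2 := ((LinearMap.funLeft ℝ Coord5
    (Subtype.val : U → Coord5)).domRestrict (M.killingOn U)).quotKerEquivRange
  have e3 := Submodule.quotEquivOfEq _ _ hker
  have hrange : LinearMap.range ((LinearMap.funLeft ℝ Coord5
      (Subtype.val : U → Coord5)).domRestrict (M.killingOn U)) = M.killingFields U := by
    rw [LinearMap.range_domRestrict, killingFields]
  have e4 := LinearEquiv.ofEq _ _ hrange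
  have e := ((e4.symm.trans e2.symm).trans e3.symm).trans e1
  rw [e.rank_eq, ← Module.finrank_eq_rank]
  simp

end Rank

end GodelType

/-! ### Explicit Killing fields. -/

/-- The solutions of `b'' = ε - κ b`, `b(y₀) = 0`, `b'(y₀) = δ`. -/
theorem exists_oscillator (κ ε δ y0 : ℝ) : ∃ b b1 : ℝ → ℝ,
    ContDiff ℝ (⊤ : ℕ∞) b ∧ ContDiff ℝ (⊤ : ℕ∞) b1 ∧ (∀ y, HasDerivAt b (b1 y) y) ∧
      (∀ y, HasDerivAt b1 (ε - κ * b y) y) ∧ b y0 = 0 ∧ b1 y0 = δ := by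
  have hlin : ∀ r y : ℝ, HasDerivAt (fun y => r * (y - y0)) r y := fun r y => by
    simpa using ((hasDerivAt_id y).sub_const y0).const_mul r
  rcases lt_trichotomy κ 0 with h | rfl | h
  · obtain ⟨r, hr, hκ⟩ : ∃ r : ℝ, r ≠ 0 ∧ κ = -r ^ 2 :=
      ⟨√(-κ), (Real.sqrt_pos.2 (by linarith)).ne', by rw [Real.sq_sqrt (by linarith)]; ring⟩
    refine ⟨fun y => δ / r * Real.sinh (r * (y - y0)) + ε / r ^ 2 * (Real.cosh (r * (y - y0)) - 1),
      fun y => δ * Real.cosh (r * (y - y0)) + ε / r * Real.sinh (r * (y - y0)),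
      by fun_prop, by fun_prop, fun y => ?_, fun y => ?_, by simp, by simp⟩
    · refine (((hlin r y).sinh.const_mul (δ / r)).add
        (((hlin r y).cosh.sub_const 1).const_mul (ε / r ^ 2))).congr_deriv ?_
      field_simp
    · refine (((hlin r y).cosh.const_mul δ).add
        ((hlin r y).sinh.const_mul (ε / r))).congr_deriv ?_
      rw [hκ]
      field_simp
      ring
  · refine ⟨fun y => δ * (y - y0) + ε / 2 * (y - y0) ^ 2, fun y => δ + ε * (y - y0),
      by fun_prop, by fun_prop, fun y => ?_, fun y => ?_, by simp, by simp⟩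
    · refine ((hlin δ y).add ((((hasDerivAt_id y).sub_const y0).pow 2).const_mul
        (ε / 2))).congr_deriv ?_
      simp
      ring
    · refine ((hlin ε y).const_add δ).congr_deriv ?_
      ring
  · obtain ⟨r, hr, hκ⟩ : ∃ r : ℝ, r ≠ 0 ∧ κ = r ^ 2 :=
      ⟨√κ, (Real.sqrt_pos.2 h).ne', by rw [Real.sq_sqrt h.le]⟩
    refine ⟨fun y => δ / r * Real.sin (r * (y - y0)) + ε / r ^ 2 * (1 - Real.cos (r * (y - y0))),
      fun y => δ * Real.cos (r * (y - y0)) + ε / r * Real.sin (r * (y - y0)),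
      by fun_prop, by fun_prop, fun y => ?_, fun y => ?_, by simp, by simp⟩
    · refine (((hlin r y).sin.const_mul (δ / r)).add
        (((hlin r y).cos.const_sub 1).const_mul (ε / r ^ 2))).congr_deriv ?_
      field_simp
    · refine (((hlin r y).cos.const_mul δ).add
        ((hlin r y).sin.const_mul (ε / r))).congr_deriv ?_
      rw [hκ]
      field_simp
      ring

namespace GodelType

section Fields

variable {M : GodelType} {m2 ω : ℝ}

theorem exists_antiderivative {f : ℝ → ℝ} (hf : ContDiffOn ℝ (⊤ : ℕ∞) f M.I) {x0 : ℝ}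
    (hx0 : x0 ∈ M.I) : ∃ F : ℝ → ℝ, ContDiffOn ℝ (⊤ : ℕ∞) F M.I ∧
      (∀ x ∈ M.I, HasDerivAt F (f x) x) ∧ F x0 = 0 := by
  have hd : ∀ x ∈ M.I, HasDerivAt (fun u => ∫ t in x0..u, f t) (f x) x := fun x hx => by
    refine intervalIntegral.integral_hasDerivAt_right ?_ ?_ ?_
    · refine (hf.continuousOn.mono ?_).intervalIntegrable
      exact M.isConnected_I.isPreconnected.ordConnected.uIcc_subset hx0 hx
    · exact hf.continuousOn.stronglyMeasurableAtFilter M.isOpen_I x hx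
    · exact hf.continuousOn.continuousAt (M.isOpen_I.mem_nhds hx)
  refine ⟨_, (contDiffOn_infty_iff_deriv_of_isOpen M.isOpen_I).2
    ⟨fun x hx => (hd x hx).differentiableAt.differentiableWithinAt,
      hf.congr fun x hx => (hd x hx).deriv⟩, hd, by simp⟩

theorem eq_of_hasDerivAt_zero {f : ℝ → ℝ} (hf : ∀ x ∈ M.I, HasDerivAt f 0 x) {x y : ℝ}
    (hx : x ∈ M.I) (hy : y ∈ M.I) : f x = f y :=
  M.isOpen_I.is_const_of_deriv_eq_zero M.isConnected_I.isPreconnected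
    (fun z hz => (hf z hz).differentiableAt.differentiableWithinAt)
    (fun z hz => (hf z hz).deriv) hx hy

theorem HasParameters.deriv_H (h : M.HasParameters m2 ω) {x : ℝ} (hx : x ∈ M.I) :
    deriv M.H x = -2 * ω * M.D x := by
  rw [← (h x hx).1, div_mul_cancel₀ _ (M.D_pos hx).ne']

theorem HasParameters.deriv_deriv_D (h : M.HasParameters m2 ω) {x : ℝ} (hx : x ∈ M.I) :
    deriv (deriv M.D) x = m2 * M.D x := by
  rw [← (h x hx).2, div_mul_cancel₀ _ (M.D_pos hx).ne']

/-- The constant is `κ = D'² - m² D²`, a first integral of `D'' = m² D`. -/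
theorem HasParameters.exists_hasDerivAt (h : M.HasParameters m2 ω) : ∃ κ : ℝ, ∀ x ∈ M.I,
    HasDerivAt (fun x => deriv M.D x / M.D x) (-κ / M.D x ^ 2) x := by
  obtain ⟨x0, hx0⟩ := M.isConnected_I.nonempty
  refine ⟨deriv M.D x0 ^ 2 - m2 * M.D x0 ^ 2, fun x hx => ?_⟩
  have hD := (M.D_pos hx).ne'
  have hc : deriv M.D x ^ 2 - m2 * M.D x ^ 2 = deriv M.D x0 ^ 2 - m2 * M.D x0 ^ 2 := by
    refine eq_of_hasDerivAt_zero (M := M) (f := fun x => deriv M.D x ^ 2 - m2 * M.D x ^ 2)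
      (fun y hy => ?_) hx hx0
    refine (((hasDerivAt_of_smooth M.smooth_deriv_D hy).pow 2).sub
      (((hasDerivAt_of_smooth M.smooth_D hy).pow 2).const_mul m2)).congr_deriv ?_
    rw [h.deriv_deriv_D hy]
    simp
    ring
  refine ((hasDerivAt_of_smooth M.smooth_deriv_D hx).div (hasDerivAt_of_smooth M.smooth_D hx)
    hD).congr_deriv ?_
  rw [h.deriv_deriv_D hx, ← hc]
  congr 1
  ring

theorem hasFDerivAt_coord {f : ℝ → ℝ} {f' : ℝ} {q : Coord5} (i : Fin 5)
    (hf : HasDerivAt f f' (q i)) : HasFDerivAt (fun q : Coord5 => f (q i))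
      (f' • ContinuousLinearMap.proj (R := ℝ) (φ := fun _ : Fin 5 => ℝ) i) q :=
  hf.comp_hasFDerivAt (x := q) (f := fun p : Coord5 => p i) (hasFDerivAt_apply i q)

theorem hasFDerivAt_vec {k0 k1 k2 k3 k4 : Coord5 → ℝ} {l0 l1 l2 l3 l4 : Coord5 →L[ℝ] ℝ}
    {q : Coord5} (h0 : HasFDerivAt k0 l0 q) (h1 : HasFDerivAt k1 l1 q) (h2 : HasFDerivAt k2 l2 q)
    (h3 : HasFDerivAt k3 l3 q) (h4 : HasFDerivAt k4 l4 q) :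
    HasFDerivAt (fun q => ![k0 q, k1 q, k2 q, k3 q, k4 q])
      (ContinuousLinearMap.pi ![l0, l1, l2, l3, l4]) q := by
  rw [hasFDerivAt_pi']
  intro i
  fin_cases i
  exacts [h0, h1, h2, h3, h4]

theorem pi_vec_apply (l0 l1 l2 l3 l4 : Coord5 →L[ℝ] ℝ) (v : Coord5) :
    ContinuousLinearMap.pi ![l0, l1, l2, l3, l4] v = ![l0 v, l1 v, l2 v, l3 v, l4 v] := by
  ext i
  fin_cases i <;> rfl

theorem contDiffAt_vec {k0 k1 k2 k3 k4 : Coord5 → ℝ} {q : Coord5}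
    (h0 : ContDiffAt ℝ (⊤ : ℕ∞) k0 q) (h1 : ContDiffAt ℝ (⊤ : ℕ∞) k1 q)
    (h2 : ContDiffAt ℝ (⊤ : ℕ∞) k2 q) (h3 : ContDiffAt ℝ (⊤ : ℕ∞) k3 q)
    (h4 : ContDiffAt ℝ (⊤ : ℕ∞) k4 q) :
    ContDiffAt ℝ (⊤ : ℕ∞) (fun q => ![k0 q, k1 q, k2 q, k3 q, k4 q]) q := by
  rw [contDiffAt_pi]
  intro i
  fin_cases i
  exacts [h0, h1, h2, h3, h4]

theorem contDiffAt_comp_coord {f : ℝ → ℝ} (hf : ContDiffOn ℝ (⊤ : ℕ∞) f M.I) {q : Coord5}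
    (hq : q ∈ M.carrier) : ContDiffAt ℝ (⊤ : ℕ∞) (fun q : Coord5 => f (q 1)) q :=
  (contDiffOn_comp_coord hf).contDiffAt (M.isOpen_carrier.mem_nhds hq)

/-- The translations along `t`, `y`, `z`, `u`. -/
theorem const_mem_killingOn (v : Coord5) (hv : v 1 = 0) :
    (fun _ => v) ∈ M.killingOn M.carrier := by
  intro q hq
  refine ⟨contDiffAt_const, fun a b => ?_⟩
  rw [lieDerivMetric_eq hq, fderiv_metricL_apply M hq, hv]
  simp

/-- The rotation of the flat plane `z, u`. -/
theorem rotation_mem_killingOn (z0 u0 : ℝ) :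
    (fun q => ![0, 0, 0, q 4 - u0, -(q 3 - z0)] : Coord5 → Coord5) ∈ M.killingOn M.carrier ∧
    ∀ q v : Coord5, fderiv ℝ (fun q => ![0, 0, 0, q 4 - u0, -(q 3 - z0)] : Coord5 → Coord5) q v =
      ![0, 0, 0, v 4, -v 3] := by
  have hd : ∀ q v : Coord5, fderiv ℝ (fun q => ![0, 0, 0, q 4 - u0, -(q 3 - z0)] : Coord5 → Coord5)
      q v = ![0, 0, 0, v 4, -v 3] := fun q v => by
    rw [(hasFDerivAt_vec (hasFDerivAt_const (0 : ℝ) q) (hasFDerivAt_const (0 : ℝ) q)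
      (hasFDerivAt_const (0 : ℝ) q) ((hasFDerivAt_apply (4 : Fin 5) q).sub_const u0)
      ((hasFDerivAt_apply (3 : Fin 5) q).sub_const z0).fun_neg).fderiv, pi_vec_apply]
    simp
  refine ⟨fun q hq => ⟨contDiffAt_vec contDiffAt_const contDiffAt_const contDiffAt_const
    (by fun_prop) (by fun_prop), fun v w => ?_⟩, hd⟩
  rw [lieDerivMetric_eq hq, fderiv_metricL_apply M hq, hd, hd, metricL_apply, metricL_apply]
  simp [metric]

/-- The lift of a Killing vector field of the surface with line element `dx² + D² dy²`. -/
theorem lift_mem_killingOn (h : M.HasParameters m2 ω) {κ ε : ℝ}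
    (hs : ∀ x ∈ M.I, HasDerivAt (fun x => deriv M.D x / M.D x) (-κ / M.D x ^ 2) x)
    {b b1 a ψ : ℝ → ℝ} (hb : ContDiff ℝ (⊤ : ℕ∞) b) (hb1 : ContDiff ℝ (⊤ : ℕ∞) b1)
    (db : ∀ y, HasDerivAt b (b1 y) y) (db1 : ∀ y, HasDerivAt b1 (ε - κ * b y) y)
    (ha : ContDiffOn ℝ (⊤ : ℕ∞) a M.I) (hψ : ContDiffOn ℝ (⊤ : ℕ∞) ψ M.I)
    (da : ∀ x ∈ M.I, HasDerivAt a (-ε / M.D x ^ 2) x)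
    (dψ : ∀ x ∈ M.I, HasDerivAt ψ (-2 * ω * M.D x * a x) x) :
    let K : Coord5 → Coord5 := fun q =>
      ![2 * ω * M.D (q 1) * b (q 2) + ψ (q 1)
          - M.H (q 1) * (a (q 1) - deriv M.D (q 1) / M.D (q 1) * b (q 2)),
        b1 (q 2), a (q 1) - deriv M.D (q 1) / M.D (q 1) * b (q 2), 0, 0]
    K ∈ M.killingOn M.carrier ∧ ∀ q ∈ M.carrier,
      (∀ v, fderiv ℝ K q v 1 = (ε - κ * b (q 2)) * v 2) ∧
      (∀ v, fderiv ℝ K q v 3 = 0) ∧ (∀ v, fderiv ℝ K q v 4 = 0) ∧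
      ∀ v, v 1 = 0 → v 2 = 0 → fderiv ℝ K q v = 0 := by
  -- The `x, y` part solves the Killing equations of the surface. The `t` component is forced by
  -- invariance of `τ = dt + H dy`: since `dτ = -2ωD dx ∧ dy`, the function `τ(K)` must have
  -- differential `2ωD (K^x dy - K^y dx)`, and `2ωD b + ψ` does.
  intro K
  have hsm : ContDiffOn ℝ (⊤ : ℕ∞) (fun x => deriv M.D x / M.D x) M.I :=
    M.smooth_deriv_D.div M.smooth_D fun x hx => (M.D_pos hx).ne'
  have hd : ∀ q ∈ M.carrier, ∀ v, fderiv ℝ K q v =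
      ![(2 * ω * deriv M.D (q 1) * b (q 2) - 2 * ω * M.D (q 1) * a (q 1)
          + 2 * ω * M.D (q 1) * (a (q 1) - deriv M.D (q 1) / M.D (q 1) * b (q 2))
          - M.H (q 1) * (-ε / M.D (q 1) ^ 2 + κ / M.D (q 1) ^ 2 * b (q 2))) * v 1
          + (2 * ω * M.D (q 1) + M.H (q 1) * (deriv M.D (q 1) / M.D (q 1))) * b1 (q 2) * v 2,
        (ε - κ * b (q 2)) * v 2,
        (-ε / M.D (q 1) ^ 2 + κ / M.D (q 1) ^ 2 * b (q 2)) * v 1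
          - deriv M.D (q 1) / M.D (q 1) * b1 (q 2) * v 2, 0, 0] := fun q hq v => by
    have fD := hasFDerivAt_coord (q := q) 1 (hasDerivAt_of_smooth M.smooth_D hq)
    have fH := hasFDerivAt_coord (q := q) 1 (hasDerivAt_of_smooth M.smooth_H hq)
    have fs := hasFDerivAt_coord (q := q) 1 (hs _ hq)
    have fa := hasFDerivAt_coord (q := q) 1 (da _ hq)
    have fψ := hasFDerivAt_coord (q := q) 1 (dψ _ hq)
    have fb := hasFDerivAt_coord (q := q) 2 (db _)
    have fb1 := hasFDerivAt_coord (q := q) 2 (db1 _)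
    have f2 := fa.sub (fs.mul fb)
    have f0 := (((fD.const_mul (2 * ω)).mul fb).add fψ).sub (fH.mul f2)
    have fK : HasFDerivAt K _ q := hasFDerivAt_vec f0 fb1 f2 (hasFDerivAt_const (0 : ℝ) q)
      (hasFDerivAt_const (0 : ℝ) q)
    rw [fK.fderiv, pi_vec_apply]
    have e := h.deriv_H hq
    ext i
    fin_cases i <;> simp [e] <;> ring
  refine ⟨fun q hq => ⟨?_, fun v w => ?_⟩, fun q hq => ⟨fun v => ?_, fun v => ?_, fun v => ?_,
    fun v hv hv' => ?_⟩⟩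
  · have cD := contDiffAt_comp_coord M.smooth_D hq
    have cH := contDiffAt_comp_coord M.smooth_H hq
    have cs := contDiffAt_comp_coord hsm hq
    have ca := contDiffAt_comp_coord ha hq
    have cψ := contDiffAt_comp_coord hψ hq
    have cb : ContDiffAt ℝ (⊤ : ℕ∞) (fun q : Coord5 => b (q 2)) q := by fun_prop
    have cb1 : ContDiffAt ℝ (⊤ : ℕ∞) (fun q : Coord5 => b1 (q 2)) q := by fun_prop
    have c2 := ca.sub (cs.mul cb)
    exact contDiffAt_vec ((((contDiffAt_const.mul cD).mul cb).add cψ).sub (cH.mul c2)) cb1 c2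
      contDiffAt_const contDiffAt_const
  · have hD := (M.D_pos hq).ne'
    have hG : M.G (q 1) = M.D (q 1) ^ 2 - M.H (q 1) ^ 2 := by rw [M.D_sq hq]; ring
    rw [lieDerivMetric_eq hq, fderiv_metricL_apply M hq, hd q hq, hd q hq, metricL_apply,
      metricL_apply, h.deriv_H hq]
    simp only [metric, hG, K]
    simp
    field_simp
    ring
  · rw [hd q hq]; simp
  · rw [hd q hq]; simp
  · rw [hd q hq]; simp
  · rw [hd q hq, hv, hv']
    ext i
    fin_cases i <;> simp

/-- The boosts in the flat part of the metric when `H` is constant. -/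
theorem boost_mem_killingOn (h : M.HasParameters m2 0) (q0 : Coord5) {k : Fin 5}
    (hk : k = 3 ∨ k = 4) :
    let K : Coord5 → Coord5 := fun q => (q k - q0 k) • Pi.single 0 1
      + (q 0 - q0 0 + M.H (q 1) * (q 2 - q0 2)) • Pi.single k 1
    K ∈ M.killingOn M.carrier ∧ ∀ q ∈ M.carrier, ∀ v, fderiv ℝ K q v =
      v k • Pi.single 0 1 + (v 0 + M.H (q 1) * v 2) • Pi.single k 1 := by
  -- For `ω = 0` the function `H` is constant, and `t + H y` is a flat time coordinate orthogonal to
  -- the surface; `K` is the boost in this coordinate and the `k`-th.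
  intro K
  have hd : ∀ q ∈ M.carrier, ∀ v, fderiv ℝ K q v =
      v k • Pi.single 0 1 + (v 0 + M.H (q 1) * v 2) • Pi.single k 1 := fun q hq v => by
    have fH := hasFDerivAt_coord (q := q) 1 (hasDerivAt_of_smooth M.smooth_H hq)
    have g := fun i : Fin 5 => (hasFDerivAt_apply (F' := fun _ => ℝ) (𝕜 := ℝ) i q).sub_const (q0 i)
    have fK : HasFDerivAt K _ q := ((g k).smul_const (Pi.single 0 1 : Coord5)).add
      (((g 0).add (fH.mul (g 2))).smul_const (Pi.single k 1 : Coord5))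
    rw [fK.fderiv]
    simp [h.deriv_H hq]
  refine ⟨fun q hq => ⟨?_, fun v w => ?_⟩, hd⟩
  · have cH := contDiffAt_comp_coord M.smooth_H hq
    have c0 : ∀ i, ContDiffAt ℝ (⊤ : ℕ∞) (fun q : Coord5 => q i - q0 i) q := fun i => by fun_prop
    exact ((c0 k).smul contDiffAt_const).add (((c0 0).add (cH.mul (c0 2))).smul contDiffAt_const)
  · rw [lieDerivMetric_eq hq, fderiv_metricL_apply M hq, hd q hq, hd q hq, metricL_apply,
      metricL_apply, h.deriv_H hq]
    rcases hk with rfl | rfl <;> simp [metric, K] <;> ring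

/-- The Killing vector fields that exist when `2 ω H + D'` is a constant `c`. -/
theorem screw_mem_killingOn (h : M.HasParameters m2 ω) {c : ℝ}
    (hc : ∀ x ∈ M.I, 2 * ω * M.H x + deriv M.D x = c) (q0 : Coord5) (θ0 : ℝ) :
    let K : Coord5 → Coord5 := fun q =>
      ![-(M.H (q 1) / M.D (q 1) * Real.sin (θ0 - 2 * ω * (q 0 - q0 0) - c * (q 2 - q0 2))),
        Real.cos (θ0 - 2 * ω * (q 0 - q0 0) - c * (q 2 - q0 2)),
        1 / M.D (q 1) * Real.sin (θ0 - 2 * ω * (q 0 - q0 0) - c * (q 2 - q0 2)), 0, 0]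
    K ∈ M.killingOn M.carrier ∧ ∀ q ∈ M.carrier,
      (∀ v, fderiv ℝ K q v 1 =
        Real.sin (θ0 - 2 * ω * (q 0 - q0 0) - c * (q 2 - q0 2)) * (2 * ω * v 0 + c * v 2)) ∧
      (∀ v, v 1 = 0 → fderiv ℝ K q v 2 = -(1 / M.D (q 1) *
        Real.cos (θ0 - 2 * ω * (q 0 - q0 0) - c * (q 2 - q0 2)) * (2 * ω * v 0 + c * v 2))) ∧
      ∀ v, fderiv ℝ K q v 3 = 0 := by
  -- `K` is the unit vector `cos θ e₁ + sin θ e₂` of the frame, with `dθ = -2ω dt - c dy = -2ω (dt +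
  -- H dy) - D' dy`. The last form is closed exactly when `D'' = 4ω² D`, which is what constancy of
  -- `c` expresses.
  intro K
  have hd : ∀ q ∈ M.carrier, ∀ v, fderiv ℝ K q v =
      ![(2 * ω + M.H (q 1) * deriv M.D (q 1) / M.D (q 1) ^ 2)
          * Real.sin (θ0 - 2 * ω * (q 0 - q0 0) - c * (q 2 - q0 2)) * v 1
          + M.H (q 1) / M.D (q 1) * Real.cos (θ0 - 2 * ω * (q 0 - q0 0) - c * (q 2 - q0 2))
          * (2 * ω * v 0 + c * v 2),
        Real.sin (θ0 - 2 * ω * (q 0 - q0 0) - c * (q 2 - q0 2)) * (2 * ω * v 0 + c * v 2),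
        -(deriv M.D (q 1) / M.D (q 1) ^ 2)
          * Real.sin (θ0 - 2 * ω * (q 0 - q0 0) - c * (q 2 - q0 2)) * v 1
          - 1 / M.D (q 1) * Real.cos (θ0 - 2 * ω * (q 0 - q0 0) - c * (q 2 - q0 2))
          * (2 * ω * v 0 + c * v 2), 0, 0] := fun q hq v => by
    have hD := (M.D_pos hq).ne'
    have dD := hasDerivAt_of_smooth M.smooth_D hq
    have f1 := hasFDerivAt_coord (q := q) 1 ((hasDerivAt_const (q 1) (1 : ℝ)).div dD hD)
    have f2 := hasFDerivAt_coord (q := q) 1 ((hasDerivAt_of_smooth M.smooth_H hq).div dD hD)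
    have g := fun i : Fin 5 => (hasFDerivAt_apply (F' := fun _ => ℝ) (𝕜 := ℝ) i q).sub_const (q0 i)
    have fθ := (((g 0).const_mul (2 * ω)).const_sub θ0).sub ((g 2).const_mul c)
    have fK : HasFDerivAt K _ q := hasFDerivAt_vec (f2.mul fθ.sin).neg fθ.cos (f1.mul fθ.sin)
      (hasFDerivAt_const (0 : ℝ) q) (hasFDerivAt_const (0 : ℝ) q)
    rw [fK.fderiv, pi_vec_apply]
    have e := h.deriv_H hq
    ext i
    fin_cases i <;> simp [e] <;> field_simp <;> ring
  refine ⟨fun q hq => ⟨?_, fun v w => ?_⟩, fun q hq => ⟨fun v => ?_, fun v hv => ?_, fun v => ?_⟩⟩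
  · have hD : M.D (q 1) ≠ 0 := (M.D_pos hq).ne'
    have cD := contDiffAt_comp_coord M.smooth_D hq
    have cH := contDiffAt_comp_coord M.smooth_H hq
    have cs : ContDiffAt ℝ (⊤ : ℕ∞) (fun q : Coord5 =>
      Real.sin (θ0 - 2 * ω * (q 0 - q0 0) - c * (q 2 - q0 2))) q := by fun_prop
    have cc : ContDiffAt ℝ (⊤ : ℕ∞) (fun q : Coord5 =>
      Real.cos (θ0 - 2 * ω * (q 0 - q0 0) - c * (q 2 - q0 2))) q := by fun_prop
    exact contDiffAt_vec ((cH.div cD hD).mul cs).neg cc ((contDiffAt_const.div cD hD).mul cs)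
      contDiffAt_const contDiffAt_const
  · have hD := (M.D_pos hq).ne'
    have hG : M.G (q 1) = M.D (q 1) ^ 2 - M.H (q 1) ^ 2 := by rw [M.D_sq hq]; ring
    rw [lieDerivMetric_eq hq, fderiv_metricL_apply M hq, hd q hq, hd q hq, metricL_apply,
      metricL_apply, h.deriv_H hq]
    simp only [metric, hG, K]
    rw [← hc _ hq]
    simp
    field_simp
    ring
  · rw [hd q hq]; simp
  · rw [hd q hq, hv]; simp
  · rw [hd q hq]; simp

end Fields

end GodelType

/-! ### Transitivity and the dimensions in the three cases. -/

namespace GodelType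

section Main

variable {M : GodelType} {m2 ω : ℝ} {p : Coord5}

theorem exists_lift (h : M.HasParameters m2 ω) (hp : p ∈ M.carrier) (δ ε : ℝ) :
    ∃ K ∈ M.killingOn M.carrier, K p = Pi.single 1 δ ∧
      M.frameMatrix p (fderiv ℝ K p) 1 2 = ε ∧ (∀ j, M.frameMatrix p (fderiv ℝ K p) 3 j = 0) ∧
      ∀ i, M.frameMatrix p (fderiv ℝ K p) i 0 = 0 := by
  have hD := (M.D_pos hp).ne'
  obtain ⟨κ, hs⟩ := h.exists_hasDerivAt
  -- The factor `D` compensates the component `1/D` of the frame vector `e₂` along `∂_y`. All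
  -- integration constants are set to zero at `p`, so that only `δ` appears in the value there.
  obtain ⟨b, b1, hb, hb1, db, db1, b0, b10⟩ := exists_oscillator κ (M.D (p 1) * ε) δ (p 2)
  obtain ⟨a, ha, da, a0⟩ := exists_antiderivative (M := M)
    (f := fun x => -(M.D (p 1) * ε) / M.D x ^ 2)
    (contDiffOn_const.div (M.smooth_D.pow 2) fun x hx => pow_ne_zero 2 (M.D_pos hx).ne') hp
  obtain ⟨ψ, hψ, dψ, ψ0⟩ := exists_antiderivative (M := M)
    (f := fun x => -2 * ω * M.D x * a x) ((contDiffOn_const.mul M.smooth_D).mul ha) hp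
  obtain ⟨hK, hd⟩ := lift_mem_killingOn h hs hb hb1 db db1 ha hψ da dψ
  obtain ⟨d1, d3, d4, d0⟩ := hd p hp
  refine ⟨_, hK, ?_, ?_, fun j => ?_, fun i => ?_⟩
  · ext i
    fin_cases i <;> simp [b0, b10, a0, ψ0]
  · simp only [frameMatrix, coframe_apply]
    simp [d1, b0, frame]
    field_simp
  · simp only [frameMatrix, coframe_apply]
    simp [d3]
  · rw [frameMatrix, d0 _ (by simp [frame]) (by simp [frame]), map_zero]
    rfl

/-- Translations correct the components of the value other than `x` and leave the derivative
unchanged. -/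
theorem exists_killing_of_apply_eq (h : M.HasParameters m2 ω) (hp : p ∈ M.carrier) (v : Coord5)
    (ε : ℝ) : ∃ K ∈ M.killingOn M.carrier, K p = v ∧
      M.frameMatrix p (fderiv ℝ K p) 1 2 = ε ∧ (∀ j, M.frameMatrix p (fderiv ℝ K p) 3 j = 0) ∧
      ∀ i, M.frameMatrix p (fderiv ℝ K p) i 0 = 0 := by
  obtain ⟨K, hK, hKp, h1, h2, h3⟩ := exists_lift h hp (v 1) ε
  have hf : fderiv ℝ (K + fun _ => v - Pi.single 1 (v 1)) p = fderiv ℝ K p := by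
    rw [fderiv_add (differentiableAt_of_mem_killingOn hK hp) (differentiableAt_const _)]
    simp
  refine ⟨K + fun _ => v - Pi.single 1 (v 1),
    add_mem hK (const_mem_killingOn _ (by simp)), ?_, ?_, ?_, ?_⟩
  · simp [hKp]
  all_goals rwa [hf]

theorem exists_rotation (p : Coord5) : ∃ K ∈ M.killingOn M.carrier, K p = 0 ∧
    ∀ v, fderiv ℝ K p v = ![0, 0, 0, v 4, -v 3] := by
  obtain ⟨hR, dR⟩ := rotation_mem_killingOn (M := M) (p 3) (p 4)
  exact ⟨_, hR, by simp, dR p⟩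

theorem exists_boost (h : M.HasParameters m2 0) (hp : p ∈ M.carrier) {k : Fin 5}
    (hk : k = 3 ∨ k = 4) : ∃ K ∈ M.killingOn M.carrier, K p = 0 ∧
      ∀ v, fderiv ℝ K p v = v k • Pi.single 0 1 + (v 0 + M.H (p 1) * v 2) • Pi.single k 1 := by
  obtain ⟨hK, dK⟩ := boost_mem_killingOn h p hk
  exact ⟨_, hK, by simp, dK p hp⟩

theorem exists_screw (h : M.HasParameters m2 ω) (hm : m2 = 4 * ω ^ 2) (hp : p ∈ M.carrier)
    (θ : ℝ) : ∃ c : ℝ, ∃ K ∈ M.killingOn M.carrier,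
      (∀ v, fderiv ℝ K p v 1 = Real.sin θ * (2 * ω * v 0 + c * v 2)) ∧
      (∀ v, v 1 = 0 →
        fderiv ℝ K p v 2 = -(1 / M.D (p 1) * Real.cos θ * (2 * ω * v 0 + c * v 2))) ∧
      ∀ v, fderiv ℝ K p v 3 = 0 := by
  -- The derivative is `-4ω² D + m² D = 0`.
  obtain ⟨c, hc⟩ : ∃ c, ∀ x ∈ M.I, 2 * ω * M.H x + deriv M.D x = c :=
    ⟨_, fun x hx => eq_of_hasDerivAt_zero (M := M) (y := p 1)
      (f := fun x => 2 * ω * M.H x + deriv M.D x) (fun y hy =>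
      (((hasDerivAt_of_smooth M.smooth_H hy).const_mul (2 * ω)).add
      (hasDerivAt_of_smooth M.smooth_deriv_D hy)).congr_deriv (by
        rw [h.deriv_H hy, h.deriv_deriv_D hy, hm]; ring)) hx hp⟩
  obtain ⟨hK, dK⟩ := screw_mem_killingOn h hc p θ
  have := dK p hp
  simp only [sub_self, mul_zero, sub_zero] at this
  exact ⟨c, _, hK, this⟩

theorem isometryGroupTransitive (h : M.HasParameters m2 ω) : M.IsometryGroupTransitive := by
  intro U _ _ hUM p v
  obtain ⟨K, hK, hKp, _⟩ := exists_killing_of_apply_eq h (hUM p.2) v 0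
  exact ⟨fun x => K x, ⟨K, killingOn_anti hUM hK, rfl⟩, hKp⟩

/-- The isotropy consists of the rotations of the `x, y` and `z, u` planes, detected by the entries
`(1, 2)` and `(3, 4)`. -/
theorem maximalIsometryGroupDim_seven (h : M.HasParameters m2 ω) (hm : m2 ≠ 4 * ω ^ 2)
    (hω : ω ≠ 0) : M.MaximalIsometryGroupDim 7 := by
  intro U hU hUc hUM
  obtain ⟨p, hpU⟩ := hUc.nonempty
  have hp := hUM hpU
  refine rank_killingFields hU hUc hUM hpU (k := 2) ![(1, 2), (3, 4)] (fun A hA h0 => ?_) ?_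
  · have hω2 : ω ^ 2 ≠ 0 := pow_ne_zero 2 hω
    have hm' : m2 - 4 * ω ^ 2 ≠ 0 := sub_ne_zero.2 hm
    obtain ⟨t1, t2⟩ := hA.frameMatrix_time h hp
    obtain ⟨f0, f1, f2, _⟩ := hA.frameMatrix_flat h hp (Or.inl rfl)
    obtain ⟨g0, g1, g2, _⟩ := hA.frameMatrix_flat h hp (Or.inr rfl)
    refine hA.eq_zero hp ((mul_eq_zero_iff_left hm').1 t1) ((mul_eq_zero_iff_left hm').1 t2)
      (h0 0) (h0 1) ?_ ?_
    · rintro i (rfl | rfl | rfl)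
      exacts [(mul_eq_zero_iff_left hω2).1 f0, (mul_eq_zero_iff_left hω2).1 f1,
        (mul_eq_zero_iff_left hω2).1 f2]
    · rintro i (rfl | rfl | rfl)
      exacts [(mul_eq_zero_iff_left hω2).1 g0, (mul_eq_zero_iff_left hω2).1 g1,
        (mul_eq_zero_iff_left hω2).1 g2]
  · rintro ⟨v, a⟩
    obtain ⟨K, hK, hKp, k1, k2, _⟩ := exists_killing_of_apply_eq h hp v (a 0)
    obtain ⟨R, hR, hRp, dR⟩ := exists_rotation (M := M) p
    refine ⟨⟨K, killingOn_anti hUM hK⟩ + a 1 • ⟨_, killingOn_anti hUM hR⟩, ?_⟩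
    rw [map_add, map_smul, jet_apply, jet_apply]
    refine Prod.ext (by simp [hKp, hRp]) (funext fun i => ?_)
    fin_cases i <;> simp [k1, k2] <;> simp [frameMatrix, dR, coframe_apply, frame]

/-- The isotropy is the Lorentz algebra of `t, x, y` together with the rotation of `z, u`. -/
theorem maximalIsometryGroupDim_nine_of_ne_zero (h : M.HasParameters m2 ω) (hm : m2 = 4 * ω ^ 2)
    (hω : ω ≠ 0) : M.MaximalIsometryGroupDim 9 := by
  intro U hU hUc hUM
  obtain ⟨p, hpU⟩ := hUc.nonempty
  have hp := hUM hpU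
  have hD := (M.D_pos hp).ne'
  refine rank_killingFields hU hUc hUM hpU (k := 4) ![(1, 2), (3, 4), (1, 0), (2, 0)]
    (fun A hA h0 => ?_) ?_
  · have hω2 : ω ^ 2 ≠ 0 := pow_ne_zero 2 hω
    obtain ⟨f0, f1, f2, _⟩ := hA.frameMatrix_flat h hp (Or.inl rfl)
    obtain ⟨g0, g1, g2, _⟩ := hA.frameMatrix_flat h hp (Or.inr rfl)
    refine hA.eq_zero hp (h0 2) (h0 3) (h0 0) (h0 1) ?_ ?_
    · rintro i (rfl | rfl | rfl)
      exacts [(mul_eq_zero_iff_left hω2).1 f0, (mul_eq_zero_iff_left hω2).1 f1,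
        (mul_eq_zero_iff_left hω2).1 f2]
    · rintro i (rfl | rfl | rfl)
      exacts [(mul_eq_zero_iff_left hω2).1 g0, (mul_eq_zero_iff_left hω2).1 g1,
        (mul_eq_zero_iff_left hω2).1 g2]
  · rintro ⟨v, a⟩
    obtain ⟨R, hR, hRp, dR⟩ := exists_rotation (M := M) p
    obtain ⟨_, X, hX, x1, x2, x3⟩ := exists_screw h hm hp 0
    obtain ⟨c, Y, hY, y1, y2, y3⟩ := exists_screw h hm hp (Real.pi / 2)
    simp only [Real.sin_zero, Real.cos_zero, Real.sin_pi_div_two, Real.cos_pi_div_two, mul_zero,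
      mul_one, neg_zero, zero_mul, one_mul] at x1 x2 y1 y2
    -- The entry `(2, 0)` of `X` is `-2ω` and the entry `(1, 0)` of `Y` is `2ω`, which gives their
    -- coefficients. `K` compensates the values of both at `p` and the `(1, 2)` entry of `Y`.
    obtain ⟨K, hK, hKp, k1, k2, k3⟩ := exists_killing_of_apply_eq h hp
      (v + (a 3 / (2 * ω)) • X p - (a 2 / (2 * ω)) • Y p)
      (a 0 - a 2 / (2 * ω) * (2 * ω * (-M.H (p 1) / M.D (p 1)) + c * (1 / M.D (p 1))))
    refine ⟨⟨K, killingOn_anti hUM hK⟩ + a 1 • ⟨_, killingOn_anti hUM hR⟩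
      - (a 3 / (2 * ω)) • ⟨_, killingOn_anti hUM hX⟩
      + (a 2 / (2 * ω)) • ⟨_, killingOn_anti hUM hY⟩, ?_⟩
    rw [map_add, map_sub, map_add, map_smul, map_smul, map_smul, jet_apply, jet_apply, jet_apply,
      jet_apply]
    refine Prod.ext (by simp [hKp, hRp]; abel) (funext fun i => ?_)
    have x2' := x2 ![1, 0, 0, 0, 0] rfl
    have y2' := y2 ![1, 0, 0, 0, 0] rfl
    fin_cases i <;> simp [k1, k2, k3] <;>
      simp [frameMatrix, dR, coframe_apply, frame, x1, x2', x3, y1, y2', y3] <;> field_simp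

/-- The curvature of the surface separates it from the flat directions, so the isotropy is the
rotation of the surface together with the Lorentz algebra of `t, z, u`. -/
theorem maximalIsometryGroupDim_nine_of_eq_zero (h : M.HasParameters m2 0) (hm : m2 ≠ 0) :
    M.MaximalIsometryGroupDim 9 := by
  intro U hU hUc hUM
  obtain ⟨p, hpU⟩ := hUc.nonempty
  have hp := hUM hpU
  refine rank_killingFields hU hUc hUM hpU (k := 4) ![(1, 2), (3, 4), (3, 0), (4, 0)]
    (fun A hA h0 => ?_) ?_
  · obtain ⟨t1, t2⟩ := hA.frameMatrix_time h hp
    obtain ⟨_, _, _, f1, f2⟩ := hA.frameMatrix_flat h hp (Or.inl rfl)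
    obtain ⟨_, _, _, g1, g2⟩ := hA.frameMatrix_flat h hp (Or.inr rfl)
    simp [hm] at t1 t2 f1 f2 g1 g2
    obtain ⟨-, s2, -⟩ := hA.skew hp
    refine hA.eq_zero hp t1 t2 (h0 0) (h0 1) ?_ ?_
    · rintro i (rfl | rfl | rfl)
      exacts [(s2 3 (by decide)).trans (h0 2), f1, f2]
    · rintro i (rfl | rfl | rfl)
      exacts [(s2 4 (by decide)).trans (h0 3), g1, g2]
  · rintro ⟨v, a⟩
    obtain ⟨K, hK, hKp, k1, k2, k3⟩ := exists_killing_of_apply_eq h hp v (a 0)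
    obtain ⟨R, hR, hRp, dR⟩ := exists_rotation (M := M) p
    obtain ⟨X, hX, hXp, dX⟩ := exists_boost h hp (k := 3) (Or.inl rfl)
    obtain ⟨Y, hY, hYp, dY⟩ := exists_boost h hp (k := 4) (Or.inr rfl)
    refine ⟨⟨K, killingOn_anti hUM hK⟩ + a 1 • ⟨_, killingOn_anti hUM hR⟩
      + a 2 • ⟨_, killingOn_anti hUM hX⟩ + a 3 • ⟨_, killingOn_anti hUM hY⟩, ?_⟩
    rw [map_add, map_add, map_add, map_smul, map_smul, map_smul, jet_apply, jet_apply, jet_apply,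
      jet_apply]
    refine Prod.ext (by simp [hKp, hRp, hXp, hYp]) (funext fun i => ?_)
    fin_cases i <;> simp [k1, k2, k3] <;> simp [frameMatrix, dR, coframe_apply, frame, dX, dY]

end Main

end GodelType

theorem theorem2 (M : GodelType) (hM : M.IsLocallyHomogeneous) :
    ∃ m2 ω : ℝ, M.HasParameters m2 ω ∧
      M.IsometryGroupTransitive ∧
      (m2 ≠ 4 * ω ^ 2 ∧ ω ≠ 0 → M.MaximalIsometryGroupDim 7) ∧
      ((m2 = 4 * ω ^ 2 ∧ ω ≠ 0) ∨ (m2 ≠ 0 ∧ ω = 0) → M.MaximalIsometryGroupDim 9) := by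
  obtain ⟨m2, ω, h⟩ := hM.exists_hasParameters
  refine ⟨m2, ω, h, GodelType.isometryGroupTransitive h,
    fun ⟨hm, hω⟩ => GodelType.maximalIsometryGroupDim_seven h hm hω, ?_⟩
  rintro (⟨hm, hω⟩ | ⟨hm, rfl⟩)
  · exact GodelType.maximalIsometryGroupDim_nine_of_ne_zero h hm hω
  · exact GodelType.maximalIsometryGroupDim_nine_of_eq_zero h hm
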